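/- Let $m>34$, $\lambda=\sqrt{1+m^2}-m$ and $p=-i\,d/dx$ on $L^2(\mathbb R)$. For a real function $\sigma$ the operator $\sigma(p)$ (and likewise $\sqrt{-\Delta+m^2}-m$ on $L^2(\mathbb R^3)$) is defined by the Fourier transform on its maximal domain. Put $g(x)=2x-\sin 2x$ and $$\tilde h(x)=\frac1{1+g(|x|)},\qquad \tilde f=\Big(\sqrt{(p+1)^2+m^2}+\sqrt{(p-1)^2+m^2}\Big)\tilde h,\qquad \tilde u(x)=\tilde f(x)\sin x,$$ $$\tilde V(x)=\lambda-\frac{1}{\tilde u(x)}\Big(\big(\sqrt{p^2+m^2}-m\big)\tilde u\Big)(x)\quad\text{for a.e. }x\in\mathbb R .$$ These objects are well defined: $\tilde h\in L^2(\mathbb R)$ lies in the domain of $\sqrt{(p+1)^2+m^2}+\sqrt{(p-1)^2+m^2}$, $\tilde u\in L^2(\mathbb R)$ lies in the domain of $\sqrt{p^2+m^2}-m$, $\tilde u\neq0$ almost everywhere, and $\tilde V$ is real-valued almost everywhere. Let $\tilde W(x)=\tilde V(|x|)$ for a.e. $x\in\mathbb R^3$, and let $\tilde H_{\rm r}=\sqrt{-\Delta+m^2}-m+\tilde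 W$ on $L^2(\mathbb R^3)$, with domain the set of all $\psi$ in the domain of $\sqrt{-\Delta+m^2}$ with $\tilde W\psi\in L^2(\mathbb R^3)$. Then $$\tilde v(x)=\frac{\tilde u(|x|)}{\sqrt{4\pi}\,|x|}$$ is a nonzero element of $L^2(\mathbb R^3)$, lies in $D(\tilde H_{\rm r})$, and satisfies $\tilde H_{\rm r}\tilde v=\lambda\tilde v$. -/

import Mathlib

open MeasureTheory
open scoped FourierTransform

noncomputable section

/-- The complex Hilbert space `L²(E)` with respect to Lebesgue measure. -/
abbrev L2 (E : Type*) [NormedAddCommGroup E] [InnerProductSpace ℝ E] [FiniteDimensional ℝ E]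
    [MeasurableSpace E] [BorelSpace E] : Type _ :=
  Lp ℂ 2 (volume : Measure E)

section Operators

variable {E : Type*} [NormedAddCommGroup E] [InnerProductSpace ℝ E] [FiniteDimensional ℝ E]
  [MeasurableSpace E] [BorelSpace E]

/-- The maximal multiplication operator by `W` on `L²(E)`:
its domain is `{ψ ∈ L² : W ψ ∈ L²}`. It depends only on the a.e. class of `W`. -/
def mulOp (W : E → ℂ) : L2 E →ₗ.[ℂ] L2 E where
  domain :=
    { carrier := {ψ | MemLp (fun x => W x * ψ x) 2 volume}
      zero_mem' := by
        have h0 : MemLp (0 : E → ℂ) 2 volume := MemLp.zero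
        refine h0.ae_eq ?_
        filter_upwards [Lp.coeFn_zero ℂ 2 (volume : Measure E)] with x hx
        rw [hx, Pi.zero_apply, mul_zero]
      add_mem' := by
        intro a b ha hb
        refine (MemLp.add ha hb).ae_eq ?_
        filter_upwards [Lp.coeFn_add a b] with x hx
        rw [hx, Pi.add_apply, Pi.add_apply, mul_add]
      smul_mem' := by
        intro c a ha
        refine (MemLp.const_smul ha c).ae_eq ?_
        filter_upwards [Lp.coeFn_smul c a] with x hx
        simp [hx, mul_left_comm] }
  toFun :=
    { toFun := fun ψ => MemLp.toLp (fun x => W x * (ψ : L2 E) x) ψ.2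
      map_add' := by
        intro a b
        rw [← MemLp.toLp_add]
        apply MemLp.toLp_congr
        filter_upwards [Lp.coeFn_add (a : L2 E) (b : L2 E)] with x hx
        exact (congrArg (W x * ·) hx).trans (mul_add _ _ _)
      map_smul' := by
        intro c a
        rw [RingHom.id_apply, ← MemLp.toLp_const_smul]
        apply MemLp.toLp_congr
        filter_upwards [Lp.coeFn_smul c (a : L2 E)] with x hx
        simp [hx, mul_left_comm] }

/-- The operator `σ(p)`, `p = -i∇`, on `L²(E)`, with its maximal domain. It is the conjugate by the
`L²` Fourier transform of a multiplication operator; since the Fourier kernel is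
`exp (-2πi⟨x, ξ⟩)`, the momentum `p` is multiplication by `2πξ` on the Fourier side. -/
def momentumOp (σ : E → ℝ) : L2 E →ₗ.[ℂ] L2 E where
  domain := (mulOp (fun ξ : E => (σ ((2 * Real.pi) • ξ) : ℂ))).domain.comap
    (Lp.fourierTransformₗᵢ E ℂ).toLinearEquiv.toLinearMap
  toFun :=
    { toFun := fun ψ => (Lp.fourierTransformₗᵢ E ℂ).symm
        (mulOp (fun ξ : E => (σ ((2 * Real.pi) • ξ) : ℂ)) ⟨Lp.fourierTransformₗᵢ E ℂ ψ, ψ.2⟩)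
      map_add' := by
        intro a b
        rw [← map_add, ← LinearPMap.map_add]
        congr 2
        apply Subtype.ext
        simp
      map_smul' := by
        intro c a
        rw [RingHom.id_apply, ← map_smul, ← LinearPMap.map_smul]
        congr 2
        apply Subtype.ext
        simp }

/-- The free relativistic Hamiltonian `√(-Δ + m²) - m` on `L²(E)`. -/
def relKinetic (E : Type*) [NormedAddCommGroup E] [InnerProductSpace ℝ E] [FiniteDimensional ℝ E]
    [MeasurableSpace E] [BorelSpace E] (m : ℝ) : L2 E →ₗ.[ℂ] L2 E :=
  momentumOp (fun k : E => √(‖k‖ ^ 2 + m ^ 2) - m)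

/-- The relativistic Schrödinger operator `√(-Δ + m²) - m + W` on `L²(E)`, as an operator sum; its
domain is the intersection of the domains of the two summands. -/
def relSchrodinger (m : ℝ) (W : E → ℂ) : L2 E →ₗ.[ℂ] L2 E :=
  relKinetic E m + mulOp W

open Classical in
/-- The value `T ψ` of a partially defined operator, with the convention `0` off its domain. -/
def opValue (T : L2 E →ₗ.[ℂ] L2 E) (ψ : L2 E) : L2 E :=
  if h : ψ ∈ T.domain then T ⟨ψ, h⟩ else 0

end Operators

namespace MosesTuan

/-- `g(x) = 2x - sin 2x`. -/
def g (x : ℝ) : ℝ := 2 * x - Real.sin (2 * x)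

/-- `h̃(x) = 1 / (1 + g(|x|))`. -/
def h (x : ℝ) : ℝ := 1 / (1 + g |x|)

lemma one_add_g_abs_ge (x : ℝ) : (1 + |x|) / 2 ≤ 1 + g |x| := by
  have h1 : Real.sin (2 * |x|) ≤ 2 * |x| := Real.sin_le (by positivity)
  have h2 := Real.sin_le_one (2 * |x|)
  unfold g
  linarith [abs_nonneg x]

lemma continuous_h : Continuous h := by
  unfold h
  refine continuous_const.div (by unfold g; fun_prop) fun x => ?_
  have := one_add_g_abs_ge x
  have := abs_nonneg x
  linarith

lemma memLp_h : MemLp (fun x : ℝ => (h x : ℂ)) 2 volume := by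
  have hc : Continuous (fun x : ℝ => (h x : ℂ)) := Complex.continuous_ofReal.comp continuous_h
  rw [memLp_two_iff_integrable_sq_norm hc.aestronglyMeasurable]
  have hi : Integrable (fun x : ℝ => (1 + ‖x‖) ^ (-(2 : ℝ))) volume :=
    integrable_one_add_norm (by simp)
  refine (hi.const_mul 4).mono' (hc.norm.pow 2).aestronglyMeasurable (Filter.Eventually.of_forall fun x => ?_)
  have h1 := one_add_g_abs_ge x
  have h2 : 0 < 1 + |x| := by positivity
  have h3 : 0 ≤ h x := by unfold h; exact one_div_nonneg.2 (by linarith)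
  have h4 : h x ≤ 2 / (1 + |x|) := by
    unfold h
    rw [div_le_div_iff₀ (by linarith) h2]
    linarith
  rw [Real.rpow_neg (by positivity), Real.norm_eq_abs, Real.norm_eq_abs]
  have h5 : (1 + |x|) ^ (2 : ℝ) = (1 + |x|) ^ 2 := by norm_cast
  rw [h5, Complex.norm_real, Real.norm_eq_abs, sq_abs, abs_of_nonneg (by positivity)]
  calc h x ^ 2 ≤ (2 / (1 + |x|)) ^ 2 := by gcongr
    _ = 4 * ((1 + |x|) ^ 2)⁻¹ := by rw [div_pow]; norm_num [div_eq_mul_inv]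

/-- `h̃` as an element of `L²(ℝ)`. -/
def hL2 : L2 ℝ := memLp_h.toLp

/-- The operator `√((p+1)² + m²) + √((p-1)² + m²)` on `L²(ℝ)`. -/
def shiftOp (m : ℝ) : L2 ℝ →ₗ.[ℂ] L2 ℝ :=
  momentumOp (fun k : ℝ => √((k + 1) ^ 2 + m ^ 2)) +
    momentumOp (fun k : ℝ => √((k - 1) ^ 2 + m ^ 2))

/-- `f̃ = (√((p+1)² + m²) + √((p-1)² + m²)) h̃`. -/
def f (m : ℝ) : L2 ℝ := opValue (shiftOp m) hL2

lemma memLp_f_mul_sin (m : ℝ) :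
    MemLp (fun x : ℝ => f m x * (Real.sin x : ℂ)) 2 volume := by
  refine (Lp.memLp (f m)).of_le ?_ (Filter.Eventually.of_forall fun x => ?_)
  · exact (Lp.aestronglyMeasurable (f m)).mul
      (Complex.continuous_ofReal.comp Real.continuous_sin).aestronglyMeasurable
  · rw [norm_mul, Complex.norm_real, Real.norm_eq_abs]
    exact mul_le_of_le_one_right (norm_nonneg _) (Real.abs_sin_le_one x)

/-- `ũ(x) = f̃(x) sin x`. -/
def u (m : ℝ) : L2 ℝ := (memLp_f_mul_sin m).toLp

/-- `λ = √(1 + m²) - m`. -/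
def eigval (m : ℝ) : ℝ := √(1 + m ^ 2) - m

/-- `Ṽ(x) = λ - (1 / ũ(x)) ((√(p² + m²) - m) ũ)(x)`, an almost everywhere defined function. -/
def V (m : ℝ) (x : ℝ) : ℂ := eigval m - opValue (relKinetic ℝ m) (u m) x / u m x

/-- `W̃(x) = Ṽ(|x|)` on `ℝ³`. -/
def W (m : ℝ) (x : EuclideanSpace ℝ (Fin 3)) : ℂ := V m ‖x‖

/-- `ṽ(x) = ũ(|x|) / (√(4π) |x|)` on `ℝ³`. -/
def v (m : ℝ) (x : EuclideanSpace ℝ (Fin 3)) : ℂ := u m ‖x‖ / ((√(4 * Real.pi) * ‖x‖ : ℝ) : ℂ)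

/-- `H̃_r = √(-Δ + m²) - m + W̃` on `L²(ℝ³)`. -/
def Hr (m : ℝ) : L2 (EuclideanSpace ℝ (Fin 3)) →ₗ.[ℂ] L2 (EuclideanSpace ℝ (Fin 3)) :=
  relSchrodinger m (W m)

end MosesTuan

end

noncomputable section

open SchwartzMap in
/-- The `L²` Fourier transform satisfies the multiplication formula against Schwartz functions. -/
theorem integral_fourier_mul_L2 {E : Type*} [NormedAddCommGroup E] [InnerProductSpace ℝ E]
    [FiniteDimensional ℝ E] [MeasurableSpace E] [BorelSpace E] (ψ : L2 E) (g : 𝓢(E, ℂ)) :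
    ∫ x, (𝓕 g) x * ψ x = ∫ x, g x * Lp.fourierTransformₗᵢ E ℂ ψ x := by
  have h := congrArg (fun T : 𝓢'(E, ℂ) => T g) (Lp.fourier_toTemperedDistribution_eq ψ)
  change _ = ∫ x, g x * (𝓕 ψ : L2 E) x
  simpa [TemperedDistribution.fourier_apply] using h

open SchwartzMap in
/-- The `L²` Fourier transform is determined by its pairings with Schwartz functions. -/
theorem fourier_ae_eq_of_integral_mul {E : Type*} [NormedAddCommGroup E] [InnerProductSpace ℝ E]
    [FiniteDimensional ℝ E] [MeasurableSpace E] [BorelSpace E] (ψ : L2 E) {χ : E → ℂ}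
    (hχ : LocallyIntegrable χ) (h : ∀ g : 𝓢(E, ℂ), ∫ x, (𝓕 g) x * ψ x = ∫ x, g x * χ x) :
    Lp.fourierTransformₗᵢ E ℂ ψ =ᵐ[volume] χ := by
  refine ae_eq_of_integral_contDiff_smul_eq
    ((Lp.memLp _).locallyIntegrable (by norm_num)) hχ fun g hg hc => ?_
  have hg₁ : HasCompactSupport (Complex.ofRealCLM ∘ g) := hc.comp_left rfl
  have hg₂ : ContDiff ℝ (⊤ : ℕ∞) (Complex.ofRealCLM ∘ g) := by fun_prop
  have := (integral_fourier_mul_L2 ψ (hg₁.toSchwartzMap hg₂)).symm.trans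
    (h (hg₁.toSchwartzMap hg₂))
  simpa using this

/-- On `L¹ ∩ L²` the `L²` Fourier transform is given by the Fourier integral. -/
theorem fourier_toLp_ae_eq {E : Type*} [NormedAddCommGroup E] [InnerProductSpace ℝ E]
    [FiniteDimensional ℝ E] [MeasurableSpace E] [BorelSpace E] {φ : E → ℂ}
    (h2 : MemLp φ 2 volume) (h1 : Integrable φ) :
    Lp.fourierTransformₗᵢ E ℂ h2.toLp =ᵐ[volume] 𝓕 φ := by
  have hcont : Continuous (𝓕 φ) :=
    VectorFourier.fourierIntegral_continuous Real.continuous_fourierChar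
      continuous_inner h1
  refine fourier_ae_eq_of_integral_mul _ hcont.locallyIntegrable fun g => ?_
  have h := VectorFourier.integral_fourierIntegral_smul_eq_flip (μ := volume) (ν := volume)
    (L := innerₗ E) (e := Real.fourierChar) Real.continuous_fourierChar continuous_inner
    g.integrable h1
  rw [flip_innerₗ] at h
  refine Eq.trans ?_ h
  refine integral_congr_ae ?_
  filter_upwards [h2.coeFn_toLp] with x hx
  rw [hx]; rfl

open SchwartzMap in
theorem fourier_reflect {E : Type*} [NormedAddCommGroup E] [InnerProductSpace ℝ E]
    [FiniteDimensional ℝ E] [MeasurableSpace E] [BorelSpace E] {ψ ψ' : L2 E}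
    (h : ψ' =ᵐ[volume] fun x => ψ (-x)) :
    Lp.fourierTransformₗᵢ E ℂ ψ' =ᵐ[volume] fun ξ => Lp.fourierTransformₗᵢ E ℂ ψ (-ξ) := by
  have hm : MemLp (fun ξ => Lp.fourierTransformₗᵢ E ℂ ψ (-ξ)) 2 volume :=
    (Lp.memLp _).comp_measurePreserving (Measure.measurePreserving_neg _)
  refine fourier_ae_eq_of_integral_mul _ (hm.locallyIntegrable (by norm_num)) fun g => ?_
  let g' : 𝓢(E, ℂ) := SchwartzMap.compCLMOfContinuousLinearEquiv ℂ (ContinuousLinearEquiv.neg ℝ) g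
  have hg' : ∀ x, g' x = g (-x) := fun x => rfl
  have hF : ∀ x, (𝓕 g') x = (𝓕 g) (-x) := fun x =>
    Real.fourier_comp_linearIsometry (LinearIsometryEquiv.neg ℝ) (g : E → ℂ) x
  calc ∫ x, (𝓕 g) x * ψ' x = ∫ x, (𝓕 g) x * ψ (-x) := by
        refine integral_congr_ae ?_
        filter_upwards [h] with x hx
        rw [hx]
    _ = ∫ x, (𝓕 g') x * ψ x := by
        rw [← integral_neg_eq_self]
        simp [hF]
    _ = ∫ x, g' x * Lp.fourierTransformₗᵢ E ℂ ψ x := integral_fourier_mul_L2 _ _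
    _ = _ := by
        rw [← integral_neg_eq_self]
        simp [hg']

open SchwartzMap ComplexConjugate in
theorem fourier_conj {E : Type*} [NormedAddCommGroup E] [InnerProductSpace ℝ E]
    [FiniteDimensional ℝ E] [MeasurableSpace E] [BorelSpace E] {ψ ψ' : L2 E}
    (h : ψ' =ᵐ[volume] fun x => conj (ψ x)) :
    Lp.fourierTransformₗᵢ E ℂ ψ' =ᵐ[volume]
      fun ξ => conj (Lp.fourierTransformₗᵢ E ℂ ψ (-ξ)) := by
  have hm : MemLp (fun ξ => conj (Lp.fourierTransformₗᵢ E ℂ ψ (-ξ))) 2 volume :=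
    ((Lp.memLp _).comp_measurePreserving (Measure.measurePreserving_neg _)).star
  refine fourier_ae_eq_of_integral_mul _ (hm.locallyIntegrable (by norm_num)) fun g => ?_
  let g' : 𝓢(E, ℂ) := (SchwartzMap.compCLMOfContinuousLinearEquiv ℝ (ContinuousLinearEquiv.neg ℝ) g).postcompCLM
    (𝕜 := ℝ) Complex.conjCLE.toContinuousLinearMap
  have hg' : ∀ x, g' x = conj (g (-x)) := fun x => rfl
  have hF : ∀ x, (𝓕 g') x = conj ((𝓕 g) x) := fun x => by
    rw [SchwartzMap.fourier_coe, SchwartzMap.fourier_coe, Real.fourier_eq', Real.fourier_eq',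
      ← integral_conj, ← integral_neg_eq_self]
    refine integral_congr_ae (Filter.Eventually.of_forall fun v => ?_)
    simp [hg', ← Complex.exp_conj, map_ofNat]
  calc ∫ x, (𝓕 g) x * ψ' x = ∫ x, (𝓕 g) x * conj (ψ x) := by
        refine integral_congr_ae ?_
        filter_upwards [h] with x hx
        rw [hx]
    _ = conj (∫ x, (𝓕 g') x * ψ x) := by
        rw [← integral_conj]
        simp [hF]
    _ = conj (∫ x, g' x * Lp.fourierTransformₗᵢ E ℂ ψ x) := by rw [integral_fourier_mul_L2]
    _ = _ := by
        rw [← integral_conj, ← integral_neg_eq_self]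
        simp [hg']

open SchwartzMap in
theorem fourier_translate (y : ℝ) {ψ ψ' : L2 ℝ}
    (h : ψ' =ᵐ[volume] fun x => ψ (x - y)) :
    Lp.fourierTransformₗᵢ ℝ ℂ ψ' =ᵐ[volume]
      fun ξ => Complex.exp (-(2 * Real.pi * ξ * y : ℝ) * Complex.I) *
        Lp.fourierTransformₗᵢ ℝ ℂ ψ ξ := by
  have hm : MemLp (fun ξ : ℝ => Complex.exp (-(2 * Real.pi * ξ * y : ℝ) * Complex.I) *
        Lp.fourierTransformₗᵢ ℝ ℂ ψ ξ) 2 volume := by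
    refine (Lp.memLp (Lp.fourierTransformₗᵢ ℝ ℂ ψ)).of_le
      ((Continuous.aestronglyMeasurable (by fun_prop)).mul (Lp.aestronglyMeasurable _))
      (Filter.Eventually.of_forall fun x => ?_)
    rw [norm_mul, ← Complex.ofReal_neg, Complex.norm_exp_ofReal_mul_I, one_mul]
  refine fourier_ae_eq_of_integral_mul _ (hm.locallyIntegrable (by norm_num)) fun g => ?_
  let k : 𝓢(ℝ, ℂ) := (𝓕 g).compSubConstCLM ℂ (-y)
  have hk : ∀ x, k x = (𝓕 g) (x + y) := fun x => by simp [k]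
  have hF : ∀ x, (𝓕⁻ k) x = Complex.exp (-(2 * Real.pi * x * y : ℝ) * Complex.I) * g x :=
    fun x => by
    have h1 : g x = (𝓕⁻ (𝓕 g)) x := by simp
    rw [h1, SchwartzMap.fourierInv_coe, SchwartzMap.fourierInv_coe, Real.fourierInv_eq',
      Real.fourierInv_eq', ← integral_const_mul]
    refine (integral_add_right_eq_self _ (-y)).symm.trans ?_
    refine integral_congr_ae (Filter.Eventually.of_forall fun v => ?_)
    simp only [hk, neg_add_cancel_right, smul_eq_mul, RCLike.inner_apply, conj_trivial]
    rw [← mul_assoc (Complex.exp _), ← Complex.exp_add]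
    congr 2
    push_cast
    ring
  calc ∫ x, (𝓕 g) x * ψ' x = ∫ x, (𝓕 g) x * ψ (x - y) := by
        refine integral_congr_ae ?_
        filter_upwards [h] with x hx
        rw [hx]
    _ = ∫ x, (𝓕 (𝓕⁻ k)) x * ψ x := by
        rw [← integral_add_right_eq_self _ y]
        simp [hk]
    _ = ∫ x, (𝓕⁻ k) x * Lp.fourierTransformₗᵢ ℝ ℂ ψ x := integral_fourier_mul_L2 _ _
    _ = _ := by
        simp only [hF]
        congr 1; ext; ring

open SchwartzMap in
theorem fourier_modulate (a : ℝ) {ψ ψ' : L2 ℝ}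
    (h : ψ' =ᵐ[volume] fun x => Complex.exp ((2 * Real.pi * a * x : ℝ) * Complex.I) * ψ x) :
    Lp.fourierTransformₗᵢ ℝ ℂ ψ' =ᵐ[volume]
      fun ξ => Lp.fourierTransformₗᵢ ℝ ℂ ψ (ξ - a) := by
  have hm : MemLp (fun ξ : ℝ => Lp.fourierTransformₗᵢ ℝ ℂ ψ (ξ - a)) 2 volume :=
    (Lp.memLp (Lp.fourierTransformₗᵢ ℝ ℂ ψ)).comp_measurePreserving
      (measurePreserving_sub_right volume a)
  refine fourier_ae_eq_of_integral_mul _ (hm.locallyIntegrable (by norm_num)) fun g => ?_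
  let k : 𝓢(ℝ, ℂ) := g.compSubConstCLM ℂ (-a)
  have hk : ∀ x, k x = g (x + a) := fun x => by simp [k]
  have hF : ∀ x, (𝓕 k) x = Complex.exp ((2 * Real.pi * a * x : ℝ) * Complex.I) * (𝓕 g) x :=
    fun x => by
    rw [SchwartzMap.fourier_coe, SchwartzMap.fourier_coe, Real.fourier_eq',
      Real.fourier_eq', ← integral_const_mul]
    refine (integral_add_right_eq_self _ (-a)).symm.trans ?_
    refine integral_congr_ae (Filter.Eventually.of_forall fun v => ?_)
    simp only [hk, neg_add_cancel_right, smul_eq_mul, RCLike.inner_apply, conj_trivial]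
    rw [← mul_assoc (Complex.exp _), ← Complex.exp_add]
    congr 2
    push_cast
    ring
  calc ∫ x, (𝓕 g) x * ψ' x = ∫ x, (𝓕 k) x * ψ x := by
        refine integral_congr_ae ?_
        filter_upwards [h] with x hx
        rw [hx, hF]; ring
    _ = ∫ x, k x * Lp.fourierTransformₗᵢ ℝ ℂ ψ x := integral_fourier_mul_L2 _ _
    _ = _ := by
        rw [← integral_add_right_eq_self (fun x => g x * Lp.fourierTransformₗᵢ ℝ ℂ ψ (x - a)) a]
        simp [hk]

open SchwartzMap in
theorem hasDerivAt_fourier_schwartz (g : 𝓢(ℝ, ℂ)) : ∃ k : 𝓢(ℝ, ℂ),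
    (∀ x, k x = -(2 * Real.pi * Complex.I) * (x * g x)) ∧
      ∀ x, HasDerivAt (𝓕 (g : ℝ → ℂ)) (𝓕 (k : ℝ → ℂ) x) x := by
  have htg : (fun x : ℝ => (x : ℂ)).HasTemperateGrowth := by fun_prop
  refine ⟨-(2 * Real.pi * Complex.I) • smulLeftCLM ℂ (fun x : ℝ => (x : ℂ)) g, fun x => ?_,
    fun x => ?_⟩
  · have := smulLeftCLM_apply_apply htg g x
    simp only [smul_apply, this]
    simp
  · have h1 : Integrable fun x : ℝ => x • g x := by
      have h2 := (smulLeftCLM ℂ (fun x : ℝ => (x : ℂ)) g).integrable (μ := volume)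
      refine h2.congr (Filter.Eventually.of_forall fun x => ?_)
      simp [smulLeftCLM_apply_apply htg g x]
    have h2 := Real.hasDerivAt_fourier g.integrable h1 x
    convert! h2 using 2
    ext y
    have := smulLeftCLM_apply_apply htg g y
    simp only [smul_apply, this]
    simp
    ring

open SchwartzMap in
/-- Differentiation of an everywhere differentiable `L²` function with `L²` derivative is
multiplication by `2πiξ` on the Fourier side. -/
theorem fourier_deriv_L2 {φ φ' : ℝ → ℂ} (hd : ∀ x, HasDerivAt φ (φ' x) x)
    (h2 : MemLp φ 2 volume) (h2' : MemLp φ' 2 volume) :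
    Lp.fourierTransformₗᵢ ℝ ℂ h2'.toLp =ᵐ[volume]
      fun ξ => (2 * Real.pi * ξ * Complex.I) * Lp.fourierTransformₗᵢ ℝ ℂ h2.toLp ξ := by
  have hl : LocallyIntegrable
      (fun ξ : ℝ => (2 * Real.pi * ξ * Complex.I) * Lp.fourierTransformₗᵢ ℝ ℂ h2.toLp ξ) := by
    rw [← locallyIntegrableOn_univ]
    refine LocallyIntegrableOn.continuousOn_mul ?_ (by fun_prop) isOpen_univ.isLocallyClosed
    exact ((Lp.memLp _).locallyIntegrable (by norm_num)).locallyIntegrableOn _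
  refine fourier_ae_eq_of_integral_mul _ hl fun g => ?_
  obtain ⟨k, hk, hkd⟩ := hasDerivAt_fourier_schwartz g
  have hi : ∀ (a : 𝓢(ℝ, ℂ)) {b : ℝ → ℂ}, MemLp b 2 volume → Integrable (⇑a * b) :=
    fun a b hb => (a.memLp 2 volume).integrable_mul hb
  have hparts : ∀ a b : 𝓢(ℝ, ℂ), (∀ x, HasDerivAt a (b x) x) →
      ∫ x, a x * φ' x = - ∫ x, b x * φ x := fun a b hab =>
    integral_mul_deriv_eq_deriv_mul_of_integrable (fun x _ => hab x) (fun x _ => hd x)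
      (hi a h2') (hi b h2) (hi a h2)
  calc ∫ x, (𝓕 g) x * (h2'.toLp φ') x = ∫ x, (𝓕 g) x * φ' x := by
        refine integral_congr_ae ?_
        filter_upwards [h2'.coeFn_toLp] with x hx
        rw [hx]
    _ = - ∫ x, (𝓕 k) x * φ x :=
        hparts (𝓕 g) (𝓕 k) hkd
    _ = - ∫ x, (𝓕 k) x * (h2.toLp φ) x := by
        congr 1
        refine integral_congr_ae ?_
        filter_upwards [h2.coeFn_toLp] with x hx
        rw [hx]
    _ = - ∫ x, k x * Lp.fourierTransformₗᵢ ℝ ℂ h2.toLp x := by rw [integral_fourier_mul_L2]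
    _ = _ := by
        rw [← integral_neg]
        congr 1; ext x; rw [hk]; ring

theorem hasDerivAt_ite_nonneg {a b a' b' : ℝ → ℝ} (ha : ∀ x, HasDerivAt a (a' x) x)
    (hb : ∀ x, HasDerivAt b (b' x) x) (h0 : a 0 = b 0) (h0' : a' 0 = b' 0) (x : ℝ) :
    HasDerivAt (fun x => if 0 ≤ x then a x else b x) (if 0 ≤ x then a' x else b' x) x := by
  rcases lt_trichotomy x 0 with hx | rfl | hx
  · rw [if_neg hx.not_ge]
    refine (hb x).congr_of_eventuallyEq ?_
    filter_upwards [Iio_mem_nhds hx] with z hz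
    exact if_neg (not_le.2 hz)
  · have h1 : HasDerivWithinAt (fun x => if 0 ≤ x then a x else b x) (a' 0) (Set.Ici 0) 0 :=
      (ha 0).hasDerivWithinAt.congr (fun z hz => if_pos hz) (if_pos le_rfl)
    have h2 : HasDerivWithinAt (fun x => if 0 ≤ x then a x else b x) (a' 0) (Set.Iic 0) 0 := by
      rw [h0']
      refine (hb 0).hasDerivWithinAt.congr (fun z hz => ?_) (by simp [h0])
      rcases (Set.mem_Iic.1 hz).eq_or_lt with rfl | hz
      · simp [h0]
      · exact if_neg (not_le.2 hz)
    have := h1.union h2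
    rw [Set.union_comm, Set.Iic_union_Ici, hasDerivWithinAt_univ] at this
    simpa using this
  · rw [if_pos hx.le]
    refine (ha x).congr_of_eventuallyEq ?_
    filter_upwards [Ioi_mem_nhds hx] with z hz
    exact if_pos (le_of_lt hz)

namespace MosesTuan

/-- The derivative of `x ↦ g |x|`. -/
def gAbsDeriv (x : ℝ) : ℝ :=
  if 0 ≤ x then 2 - 2 * Real.cos (2 * x) else -(2 - 2 * Real.cos (2 * x))

/-- The second derivative of `x ↦ g |x|`. -/
def gAbsDeriv2 (x : ℝ) : ℝ := if 0 ≤ x then 4 * Real.sin (2 * x) else -(4 * Real.sin (2 * x))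

lemma hasDerivAt_g (x : ℝ) : HasDerivAt g (2 - 2 * Real.cos (2 * x)) x := by
  have h2 : HasDerivAt (fun x : ℝ => 2 * x) 2 x := by simpa using (hasDerivAt_id x).const_mul 2
  have := h2.sub h2.sin
  rw [mul_comm (Real.cos _)] at this
  exact this

lemma hasDerivAt_g_abs (x : ℝ) : HasDerivAt (fun x => g |x|) (gAbsDeriv x) x := by
  have h := hasDerivAt_ite_nonneg hasDerivAt_g (fun x => (hasDerivAt_g x).neg)
    (by simp [g]) (by simp) x
  refine h.congr_of_eventuallyEq (Filter.Eventually.of_forall fun z => ?_)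
  dsimp only
  split_ifs with hz
  · rw [abs_of_nonneg hz]
  · rw [abs_of_neg (not_le.1 hz)]
    simp only [g, Pi.neg_apply, mul_neg, Real.sin_neg]
    ring

lemma hasDerivAt_gAbsDeriv (x : ℝ) : HasDerivAt gAbsDeriv (gAbsDeriv2 x) x := by
  have h1 : ∀ x : ℝ, HasDerivAt (fun x : ℝ => 2 - 2 * Real.cos (2 * x)) (4 * Real.sin (2 * x)) x :=
    fun x => by
      have h2 : HasDerivAt (fun x : ℝ => 2 * x) 2 x := by simpa using (hasDerivAt_id x).const_mul 2
      convert! (h2.cos.const_mul 2).const_sub 2 using 1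
      ring
  exact hasDerivAt_ite_nonneg h1 (fun x => (h1 x).neg) (by simp) (by simp) x

lemma abs_gAbsDeriv_le (x : ℝ) : |gAbsDeriv x| ≤ 4 := by
  unfold gAbsDeriv
  have := Real.neg_one_le_cos (2 * x)
  have := Real.cos_le_one (2 * x)
  split_ifs <;> rw [abs_le] <;> constructor <;> linarith

lemma abs_gAbsDeriv2_le (x : ℝ) : |gAbsDeriv2 x| ≤ 4 := by
  unfold gAbsDeriv2
  have := Real.neg_one_le_sin (2 * x)
  have := Real.sin_le_one (2 * x)
  split_ifs <;> rw [abs_le] <;> constructor <;> linarith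

lemma g_abs_nonneg (x : ℝ) : 0 ≤ g |x| := by
  have h1 : Real.sin (2 * |x|) ≤ 2 * |x| := Real.sin_le (by positivity)
  unfold g
  linarith

lemma h_pos (x : ℝ) : 0 < h x := by
  have := g_abs_nonneg x
  unfold h
  positivity

lemma h_le_one (x : ℝ) : h x ≤ 1 := by
  have := g_abs_nonneg x
  unfold h
  rw [div_le_one (by positivity)]
  linarith

/-- The derivative of `h̃`. -/
def hDeriv (x : ℝ) : ℝ := -gAbsDeriv x * h x ^ 2

/-- The second derivative of `h̃`. -/
def hDeriv2 (x : ℝ) : ℝ := 2 * gAbsDeriv x ^ 2 * h x ^ 3 - gAbsDeriv2 x * h x ^ 2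

lemma hasDerivAt_h (x : ℝ) : HasDerivAt h (hDeriv x) x := by
  have h0 : 1 + g |x| ≠ 0 := by have := g_abs_nonneg x; positivity
  have := ((hasDerivAt_g_abs x).const_add 1).inv h0
  have he : h = (fun x => 1 + g |x|)⁻¹ := by ext z; simp [h]
  rw [he]
  convert! this using 1
  rw [hDeriv, h]
  field_simp

lemma hasDerivAt_hDeriv (x : ℝ) : HasDerivAt hDeriv (hDeriv2 x) x := by
  have := (hasDerivAt_gAbsDeriv x).neg.mul ((hasDerivAt_h x).pow 2)
  convert! this using 1
  simp only [hDeriv, hDeriv2, Pi.neg_apply, Pi.pow_apply]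
  ring

lemma abs_hDeriv_le (x : ℝ) : |hDeriv x| ≤ 4 * h x := by
  have h0 := h_pos x
  have h1 := h_le_one x
  rw [hDeriv, abs_mul, abs_neg, abs_of_pos (pow_pos h0 2)]
  have : h x ^ 2 ≤ h x := by nlinarith
  exact mul_le_mul (abs_gAbsDeriv_le x) this (by positivity) (by norm_num)

lemma abs_hDeriv2_le (x : ℝ) : |hDeriv2 x| ≤ 36 * h x := by
  have h0 := h_pos x
  have h1 := h_le_one x
  have h2 : h x ^ 2 ≤ h x := by nlinarith
  have h3 : h x ^ 3 ≤ h x := by nlinarith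
  have ha : gAbsDeriv x ^ 2 ≤ 16 := by
    rw [← sq_abs]; nlinarith [abs_gAbsDeriv_le x, abs_nonneg (gAbsDeriv x)]
  have e1 : |2 * gAbsDeriv x ^ 2 * h x ^ 3| ≤ 32 * h x := by
    rw [abs_of_nonneg (by positivity)]
    exact mul_le_mul (by linarith) h3 (by positivity) (by norm_num)
  have e2 : |gAbsDeriv2 x * h x ^ 2| ≤ 4 * h x := by
    rw [abs_mul, abs_of_pos (pow_pos h0 2)]
    exact mul_le_mul (abs_gAbsDeriv2_le x) h2 (by positivity) (by norm_num)
  exact (abs_sub _ _).trans (by linarith)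

lemma abs_g_abs_sub_le (x z : ℝ) : abs (g |x| - g |z|) ≤ 4 * |x - z| := by
  have := Convex.norm_image_sub_le_of_norm_hasDerivWithin_le (f := fun x => g |x|) (s := Set.univ)
    (fun x _ => (hasDerivAt_g_abs x).hasDerivWithinAt)
    (fun x _ => abs_gAbsDeriv_le x) convex_univ (Set.mem_univ z) (Set.mem_univ x)
  simpa only [Real.norm_eq_abs] using this

/-- `h̃` varies slowly. -/
lemma h_sub_le (x y : ℝ) : h (x - y) ≤ (1 + 4 * |y|) * h x := by
  have h1 := abs_le.1 (abs_g_abs_sub_le x (x - y))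
  rw [sub_sub_cancel] at h1
  have h2 := g_abs_nonneg (x - y)
  have h3 := g_abs_nonneg x
  unfold h
  rw [mul_one_div, div_le_div_iff₀ (by positivity) (by positivity)]
  nlinarith [mul_nonneg h2 (abs_nonneg y)]

lemma le_h_sub (x y : ℝ) : (1 - 4 * |y|) * h x ≤ h (x - y) := by
  have h1 := h_sub_le (x - y) (-y)
  rw [sub_neg_eq_add, sub_add_cancel, abs_neg] at h1
  have h2 := h_pos x
  have h3 := h_pos (x - y)
  have h4 := abs_nonneg y
  by_cases h5 : 1 - 4 * |y| ≤ 0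
  · nlinarith
  · push Not at h5
    nlinarith [mul_le_mul_of_nonneg_left h1 h5.le, mul_nonneg h3.le (sq_nonneg |y|)]

lemma memLp_hDeriv : MemLp (fun x => (hDeriv x : ℂ)) 2 volume := by
  have hc : Continuous hDeriv :=
    continuous_iff_continuousAt.2 fun x => (hasDerivAt_hDeriv x).continuousAt
  refine (memLp_h.const_mul 4).of_le (by fun_prop) (Filter.Eventually.of_forall fun x => ?_)
  rw [norm_mul, Complex.norm_real, Complex.norm_real]
  simpa [abs_of_pos (h_pos x)] using abs_hDeriv_le x

lemma continuous_hDeriv2 : Continuous hDeriv2 := by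
  have h1 : Continuous gAbsDeriv :=
    continuous_iff_continuousAt.2 fun x => (hasDerivAt_gAbsDeriv x).continuousAt
  have h2 : Continuous gAbsDeriv2 := by
    unfold gAbsDeriv2
    refine Continuous.if_le (by fun_prop) (by fun_prop) (by fun_prop) (by fun_prop) fun x hx => ?_
    simp [← hx]
  have h3 := continuous_h
  unfold hDeriv2
  fun_prop

lemma memLp_hDeriv2 : MemLp (fun x => (hDeriv2 x : ℂ)) 2 volume := by
  have hc := continuous_hDeriv2
  refine (memLp_h.const_mul 36).of_le (by fun_prop) (Filter.Eventually.of_forall fun x => ?_)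
  rw [norm_mul, Complex.norm_real, Complex.norm_real]
  simpa [abs_of_pos (h_pos x)] using abs_hDeriv2_le x

/-- The Fourier transform of `h̃`. -/
def hHat : L2 ℝ := Lp.fourierTransformₗᵢ ℝ ℂ hL2

lemma fourier_hDeriv : Lp.fourierTransformₗᵢ ℝ ℂ memLp_hDeriv.toLp =ᵐ[volume]
    fun ξ => (2 * Real.pi * ξ * Complex.I) * hHat ξ :=
  fourier_deriv_L2 (fun x => (hasDerivAt_h x).ofReal_comp) memLp_h memLp_hDeriv

lemma fourier_hDeriv2 : Lp.fourierTransformₗᵢ ℝ ℂ memLp_hDeriv2.toLp =ᵐ[volume]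
    fun ξ => -(2 * Real.pi * ξ) ^ 2 * hHat ξ := by
  filter_upwards [fourier_deriv_L2 (fun x => (hasDerivAt_hDeriv x).ofReal_comp) memLp_hDeriv
    memLp_hDeriv2, fourier_hDeriv] with ξ h1 h2
  rw [h1, h2]
  linear_combination ((2 * Real.pi * ξ) ^ 2 * hHat ξ : ℂ) * Complex.I_sq

/-- `h̃` lies in the Sobolev space `H²(ℝ)`. -/
lemma memLp_sobolev_hHat :
    MemLp (fun ξ : ℝ => ((1 + (2 * Real.pi * ξ) ^ 2 : ℝ) : ℂ) * hHat ξ) 2 volume := by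
  refine ((Lp.memLp hHat).sub (Lp.memLp (Lp.fourierTransformₗᵢ ℝ ℂ memLp_hDeriv2.toLp))).ae_eq ?_
  filter_upwards [fourier_hDeriv2] with ξ h2
  rw [Pi.sub_apply, h2]
  push_cast
  ring

/-- Symbols of order two map `h̃` into `L²`. -/
lemma memLp_mul_hHat {σ : ℝ → ℝ} (hσ : Continuous σ) {C : ℝ}
    (hC : ∀ k, |σ k| ≤ C * (1 + k ^ 2)) :
    MemLp (fun ξ : ℝ => (σ (2 * Real.pi * ξ) : ℂ) * hHat ξ) 2 volume := by
  refine (memLp_sobolev_hHat.const_mul (C : ℂ)).of_le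
    ((Continuous.aestronglyMeasurable (by fun_prop)).mul (Lp.aestronglyMeasurable _))
    (Filter.Eventually.of_forall fun ξ => ?_)
  rw [norm_mul, ← mul_assoc, norm_mul _ (hHat ξ), ← Complex.ofReal_mul, Complex.norm_real,
    Complex.norm_real]
  gcongr
  exact (hC _).trans (le_abs_self _)

end MosesTuan

open ComplexConjugate in
/-- The Fourier integral of `conj (Fφ) · Fψ` is the correlation of `φ` and `ψ`. -/
theorem fourier_conj_mul_eq_inner_translate (φ ψ : L2 ℝ) {y : ℝ} {ψ' : L2 ℝ}
    (h : ψ' =ᵐ[volume] fun x => ψ (x - y)) :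
    𝓕 (fun ξ => conj (Lp.fourierTransformₗᵢ ℝ ℂ φ ξ) * Lp.fourierTransformₗᵢ ℝ ℂ ψ ξ) y =
      inner ℂ φ ψ' := by
  rw [← (Lp.fourierTransformₗᵢ ℝ ℂ).inner_map_map, L2.inner_def, Real.fourier_eq']
  refine integral_congr_ae ?_
  filter_upwards [fourier_translate y h] with ξ hξ
  rw [hξ, RCLike.inner_apply', smul_eq_mul, RCLike.inner_apply, conj_trivial]
  have he : Complex.exp ((-2 * Real.pi * (y * ξ) : ℝ) * Complex.I) =
      Complex.exp (-(2 * Real.pi * ξ * y : ℝ) * Complex.I) := by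
    congr 1
    push_cast
    ring
  have hc : ξ * y = y * ξ := mul_comm _ _
  simp only [hc] at he ⊢
  rw [he]
  ring

open ComplexConjugate in
theorem integrable_conj_mul (φ ψ : L2 ℝ) : Integrable (fun ξ => conj (φ ξ) * ψ ξ) := by
  simpa only [RCLike.inner_apply'] using L2.integrable_inner (𝕜 := ℂ) φ ψ

/-- Fubini's theorem for the Fourier integral on the line. -/
theorem integral_fourier_mul_L1 {k p : ℝ → ℂ} (hk : Integrable k) (hp : Integrable p) :
    ∫ ξ, 𝓕 k ξ * p ξ = ∫ y, k y * 𝓕 p y := by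
  have h := VectorFourier.integral_fourierIntegral_smul_eq_flip (μ := volume) (ν := volume)
    (L := innerₗ ℝ) (e := Real.fourierChar) Real.continuous_fourierChar continuous_inner hk hp
  rw [flip_innerₗ] at h
  exact h

theorem integrable_mul_fourier {k p : ℝ → ℂ} (hk : Integrable k) (hp : Integrable p) :
    Integrable fun y => k y * 𝓕 p y := by
  have hc : Continuous (𝓕 p) :=
    VectorFourier.fourierIntegral_continuous Real.continuous_fourierChar continuous_inner hp
  refine hk.mul_bdd (c := ∫ x, ‖p x‖) hc.aestronglyMeasurable
    (Filter.Eventually.of_forall fun y => ?_)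
  exact VectorFourier.norm_fourierIntegral_le_integral_norm _ _ _ _ _

/-- The kernel of `((p + ε)² + κ²)⁻¹`. -/
def resolventKernel (κ ε y : ℝ) : ℂ :=
  Complex.exp (-(κ * |y| : ℝ)) * Complex.exp (-(ε * y : ℝ) * Complex.I) / (2 * κ)

theorem integral_pow_mul_exp_neg_abs {κ : ℝ} (hκ : 0 < κ) (n : ℕ) :
    ∫ y : ℝ, |y| ^ n * Real.exp (-(κ * |y|)) = 2 * n.factorial / κ ^ (n + 1) := by
  rw [integral_comp_abs (f := fun y => y ^ n * Real.exp (-(κ * y)))]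
  have h := Real.integral_rpow_mul_exp_neg_mul_Ioi (a := n + 1) (r := κ) (by positivity) hκ
  rw [Real.Gamma_nat_eq_factorial] at h
  simp only [add_sub_cancel_right, Real.rpow_natCast] at h
  rw [h]
  have : ((n : ℝ) + 1) = ((n + 1 : ℕ) : ℝ) := by push_cast; rfl
  rw [this, Real.rpow_natCast, one_div, inv_pow]
  ring

theorem integrable_pow_mul_exp_neg_abs {κ : ℝ} (hκ : 0 < κ) (n : ℕ) :
    Integrable fun y : ℝ => |y| ^ n * Real.exp (-(κ * |y|)) := by
  refine Integrable.of_integral_ne_zero ?_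
  rw [integral_pow_mul_exp_neg_abs hκ]
  positivity

theorem integrable_resolventKernel {κ : ℝ} (hκ : 0 < κ) (ε : ℝ) :
    Integrable (resolventKernel κ ε) := by
  have h := (integrable_pow_mul_exp_neg_abs hκ 0).div_const (2 * κ)
  refine h.mono' (Continuous.aestronglyMeasurable ?_) (Filter.Eventually.of_forall fun y => ?_)
  · unfold resolventKernel
    fun_prop
  · rw [resolventKernel, norm_div, norm_mul, ← Complex.ofReal_neg, ← Complex.ofReal_neg,
      Complex.norm_exp_ofReal_mul_I, Complex.norm_exp_ofReal]
    simp [abs_of_pos hκ]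

theorem fourier_resolventKernel {κ : ℝ} (hκ : 0 < κ) (ε ξ : ℝ) :
    𝓕 (resolventKernel κ ε) ξ = (((2 * Real.pi * ξ + ε) ^ 2 + κ ^ 2 : ℝ) : ℂ)⁻¹ := by
  set a : ℝ := 2 * Real.pi * ξ + ε with ha
  have hi : Integrable fun y : ℝ =>
      Complex.exp ((-2 * Real.pi * inner ℝ y ξ : ℝ) * Complex.I) • resolventKernel κ ε y := by
    have := (Real.fourierIntegral_convergent_iff (μ := volume) ξ).2 (integrable_resolventKernel hκ ε)
    refine this.congr (Filter.Eventually.of_forall fun y => ?_)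
    simp only [Circle.smul_def, Real.fourierChar_apply]
    congr 3
    push_cast
    ring
  rw [Real.fourier_eq']
  rw [← intervalIntegral.integral_Iic_add_Ioi (b := 0) hi.integrableOn hi.integrableOn]
  have h1 : ∫ y : ℝ in Set.Iic 0, Complex.exp ((-2 * Real.pi * inner ℝ y ξ : ℝ) * Complex.I) •
      resolventKernel κ ε y = ∫ y : ℝ in Set.Iic 0,
        Complex.exp ((κ - a * Complex.I) * y) / (2 * κ) := by
    refine setIntegral_congr_fun measurableSet_Iic fun y hy => ?_
    simp only [resolventKernel, abs_of_nonpos (Set.mem_Iic.1 hy), smul_eq_mul]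
    rw [mul_div_assoc', ← Complex.exp_add, ← Complex.exp_add]
    congr 2
    simp [ha]
    ring
  have h2 : ∫ y : ℝ in Set.Ioi 0, Complex.exp ((-2 * Real.pi * inner ℝ y ξ : ℝ) * Complex.I) •
      resolventKernel κ ε y = ∫ y : ℝ in Set.Ioi 0,
        Complex.exp ((-κ - a * Complex.I) * y) / (2 * κ) := by
    refine setIntegral_congr_fun measurableSet_Ioi fun y hy => ?_
    simp only [resolventKernel, abs_of_pos (Set.mem_Ioi.1 hy), smul_eq_mul]
    rw [mul_div_assoc', ← Complex.exp_add, ← Complex.exp_add]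
    congr 2
    simp [ha]
    ring
  rw [h1, h2, integral_div, integral_div, integral_exp_mul_complex_Iic (by simpa using hκ),
    integral_exp_mul_complex_Ioi (by simpa using hκ)]
  have hκ' : (κ : ℂ) ≠ 0 := by exact_mod_cast hκ.ne'
  have n1 : (κ - a * Complex.I : ℂ) ≠ 0 := fun h => by
    have := congrArg Complex.re h
    simp at this; exact hκ.ne' this
  have n2 : (-κ - a * Complex.I : ℂ) ≠ 0 := fun h => by
    have := congrArg Complex.re h
    simp at this; exact hκ.ne' this
  have n3 : ((a ^ 2 + κ ^ 2 : ℝ) : ℂ) ≠ 0 := by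
    have : 0 < a ^ 2 + κ ^ 2 := by positivity
    exact_mod_cast this.ne'
  have e : ((a ^ 2 + κ ^ 2 : ℝ) : ℂ) = -((κ - a * Complex.I) * (-κ - a * Complex.I)) := by
    push_cast
    linear_combination (a ^ 2 : ℂ) * Complex.I_sq
  rw [e]
  simp only [Complex.ofReal_zero, mul_zero, Complex.exp_zero]
  field_simp
  ring

theorem integral_Ioi_inv_sq_add_sq {a : ℝ} (ha : 0 < a) :
    ∫ s : ℝ in Set.Ioi 0, (a ^ 2 + s ^ 2)⁻¹ = Real.pi / 2 * a⁻¹ := by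
  have h := integral_comp_mul_left_Ioi (fun x : ℝ => (1 + x ^ 2)⁻¹) 0 (inv_pos.2 ha)
  rw [mul_zero, integral_Ioi_inv_one_add_sq, Real.arctan_zero, sub_zero, inv_inv, smul_eq_mul] at h
  calc ∫ s : ℝ in Set.Ioi 0, (a ^ 2 + s ^ 2)⁻¹
      = ∫ s : ℝ in Set.Ioi 0, (a ^ 2)⁻¹ * (1 + (a⁻¹ * s) ^ 2)⁻¹ := by
        refine setIntegral_congr_fun measurableSet_Ioi fun s _ => ?_
        field_simp
    _ = _ := by
        rw [integral_const_mul, h]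
        field_simp

theorem integrableOn_Ioi_inv_sq_add_sq {a : ℝ} (ha : 0 < a) :
    IntegrableOn (fun s : ℝ => (a ^ 2 + s ^ 2)⁻¹) (Set.Ioi 0) := by
  refine Integrable.of_integral_ne_zero ?_
  rw [integral_Ioi_inv_sq_add_sq ha]
  positivity

section MomentumOp

variable {E : Type*} [NormedAddCommGroup E] [InnerProductSpace ℝ E] [FiniteDimensional ℝ E]
  [MeasurableSpace E] [BorelSpace E]

theorem mulOp_coeFn (W : E → ℂ) (ψ : (mulOp W).domain) :
    mulOp W ψ =ᵐ[volume] fun x => W x * (ψ : L2 E) x :=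
  MemLp.coeFn_toLp ψ.2

theorem fourier_momentumOp (σ : E → ℝ) (ψ : (momentumOp σ).domain) :
    Lp.fourierTransformₗᵢ E ℂ (momentumOp σ ψ) =ᵐ[volume]
      fun ξ => (σ ((2 * Real.pi) • ξ) : ℂ) * Lp.fourierTransformₗᵢ E ℂ (ψ : L2 E) ξ := by
  have h : Lp.fourierTransformₗᵢ E ℂ (momentumOp σ ψ) =
      mulOp (fun ξ : E => (σ ((2 * Real.pi) • ξ) : ℂ)) ⟨Lp.fourierTransformₗᵢ E ℂ ψ, ψ.2⟩ :=
    (Lp.fourierTransformₗᵢ E ℂ).apply_symm_apply _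
  rw [h]
  exact mulOp_coeFn _ _

theorem opValue_of_mem {T : L2 E →ₗ.[ℂ] L2 E} {ψ : L2 E} (h : ψ ∈ T.domain) :
    opValue T ψ = T ⟨ψ, h⟩ := dif_pos h

end MomentumOp

/-- Positivity of `∫ p / a` from positivity of all `∫ p / (a² + s²)`. -/
theorem re_integral_mul_inv_pos {p : ℝ → ℂ} (hp : Integrable p) {a : ℝ → ℝ} (ha : Continuous a)
    {m : ℝ} (hm : 0 < m) (hma : ∀ ξ, m ≤ a ξ)
    (hpos : ∀ s : ℝ, 0 < s → 0 < (∫ ξ, p ξ * (((a ξ ^ 2 + s ^ 2 : ℝ) : ℂ))⁻¹).re) :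
    0 < (∫ ξ, p ξ * ((a ξ : ℝ) : ℂ)⁻¹).re := by
  have hF : Integrable (Function.uncurry fun ξ s : ℝ => p ξ * (((a ξ ^ 2 + s ^ 2 : ℝ) : ℂ))⁻¹)
      (volume.prod (volume.restrict (Set.Ioi 0))) := by
    have hb := hp.norm.mul_prod (integrableOn_Ioi_inv_sq_add_sq hm)
    refine hb.mono' ?_ (Filter.Eventually.of_forall fun z => ?_)
    · refine hp.aestronglyMeasurable.comp_fst.mul (Measurable.aestronglyMeasurable ?_)
      have := ha.measurable
      fun_prop
    · simp only [Function.uncurry, norm_mul, norm_inv, Complex.norm_real]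
      have h1 := hma z.1
      rw [Real.norm_of_nonneg (by positivity)]
      gcongr
  have hS : Integrable (fun s : ℝ => ∫ ξ, p ξ * (((a ξ ^ 2 + s ^ 2 : ℝ) : ℂ))⁻¹)
      (volume.restrict (Set.Ioi 0)) := hF.integral_prod_right
  have key : ∫ s in Set.Ioi (0 : ℝ), ∫ ξ, p ξ * (((a ξ ^ 2 + s ^ 2 : ℝ) : ℂ))⁻¹ =
      (Real.pi / 2 : ℝ) * ∫ ξ, p ξ * ((a ξ : ℝ) : ℂ)⁻¹ := by
    rw [← integral_integral_swap hF, ← integral_const_mul]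
    refine integral_congr_ae (Filter.Eventually.of_forall fun ξ => ?_)
    have h0 : 0 < a ξ := hm.trans_le (hma ξ)
    simp only
    rw [integral_const_mul]
    have : ∫ s in Set.Ioi (0 : ℝ), (((a ξ ^ 2 + s ^ 2 : ℝ) : ℂ))⁻¹ =
        ((Real.pi / 2 * (a ξ)⁻¹ : ℝ) : ℂ) := by
      rw [← integral_Ioi_inv_sq_add_sq h0, ← integral_complex_ofReal]
      simp
    rw [this]
    push_cast
    ring
  have hre : 0 < (∫ s in Set.Ioi (0 : ℝ), ∫ ξ, p ξ * (((a ξ ^ 2 + s ^ 2 : ℝ) : ℂ))⁻¹).re := by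
    have h1 := integral_re hS
    simp only [RCLike.re_to_complex] at h1
    rw [← h1, setIntegral_pos_iff_support_of_nonneg_ae]
    · refine lt_of_lt_of_le ?_ (measure_mono (s := Set.Ioi (0 : ℝ)) fun s hs => ⟨?_, hs⟩)
      · simp
      · exact (hpos s hs).ne'
    · exact (ae_restrict_iff' measurableSet_Ioi).2
        (Filter.Eventually.of_forall fun s hs => (hpos s hs).le)
    · exact hS.re
  rw [key, Complex.re_ofReal_mul] at hre
  exact (mul_pos_iff_of_pos_left (by positivity)).1 hre

namespace MosesTuan

/-- The function `((p + ε)² + m²) h̃` for `ε = ±1`. -/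
def shiftedH (m ε : ℝ) (x : ℝ) : ℂ :=
  (((1 + m ^ 2) * h x - hDeriv2 x : ℝ) : ℂ) - (2 * ε * hDeriv x : ℝ) * Complex.I

/-- `((p + ε)² + m²) h̃` as an element of `L²(ℝ)`. -/
def shiftedHL2 (m ε : ℝ) : L2 ℝ :=
  ((1 + m ^ 2 : ℝ) : ℂ) • hL2 - memLp_hDeriv2.toLp -
    (((2 * ε : ℝ) : ℂ) * Complex.I) • memLp_hDeriv.toLp

lemma shiftedHL2_coeFn (m ε : ℝ) : shiftedHL2 m ε =ᵐ[volume] shiftedH m ε := by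
  unfold shiftedHL2
  filter_upwards [Lp.coeFn_sub (((1 + m ^ 2 : ℝ) : ℂ) • hL2 - memLp_hDeriv2.toLp)
      ((((2 * ε : ℝ) : ℂ) * Complex.I) • memLp_hDeriv.toLp),
    Lp.coeFn_sub (((1 + m ^ 2 : ℝ) : ℂ) • hL2) memLp_hDeriv2.toLp,
    Lp.coeFn_smul ((1 + m ^ 2 : ℝ) : ℂ) hL2,
    Lp.coeFn_smul (((2 * ε : ℝ) : ℂ) * Complex.I) memLp_hDeriv.toLp,
    memLp_h.coeFn_toLp, memLp_hDeriv.coeFn_toLp, memLp_hDeriv2.coeFn_toLp]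
    with x h1 h2 h3 h4 h5 h6 h7
  rw [h1, Pi.sub_apply, h2, Pi.sub_apply, h3, h4, Pi.smul_apply, Pi.smul_apply, h6, h7, hL2, h5,
    shiftedH]
  simp only [smul_eq_mul]
  push_cast
  ring

lemma fourier_shiftedHL2 (m : ℝ) {ε : ℝ} (hε : ε ^ 2 = 1) :
    Lp.fourierTransformₗᵢ ℝ ℂ (shiftedHL2 m ε) =ᵐ[volume]
      fun ξ => (((2 * Real.pi * ξ + ε) ^ 2 + m ^ 2 : ℝ) : ℂ) * hHat ξ := by
  unfold shiftedHL2
  rw [map_sub, map_sub, map_smul, map_smul]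
  set H1 := Lp.fourierTransformₗᵢ ℝ ℂ memLp_hDeriv.toLp with hH1
  set H2 := Lp.fourierTransformₗᵢ ℝ ℂ memLp_hDeriv2.toLp with hH2
  change (((1 + m ^ 2 : ℝ) : ℂ) • hHat - H2 - (((2 * ε : ℝ) : ℂ) * Complex.I) • H1 : L2 ℝ)
    =ᵐ[volume] _
  filter_upwards [Lp.coeFn_sub (((1 + m ^ 2 : ℝ) : ℂ) • hHat - H2)
      ((((2 * ε : ℝ) : ℂ) * Complex.I) • H1),
    Lp.coeFn_sub (((1 + m ^ 2 : ℝ) : ℂ) • hHat) H2,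
    Lp.coeFn_smul ((1 + m ^ 2 : ℝ) : ℂ) hHat,
    Lp.coeFn_smul (((2 * ε : ℝ) : ℂ) * Complex.I) H1,
    fourier_hDeriv, fourier_hDeriv2] with ξ h1 h2 h3 h4 h5 h6
  rw [h1, Pi.sub_apply, h2, Pi.sub_apply, h3, h4, Pi.smul_apply, Pi.smul_apply, h5, h6]
  simp only [smul_eq_mul]
  have hε' : (ε : ℂ) ^ 2 = 1 := by exact_mod_cast hε
  push_cast
  linear_combination (-4 * ε * Real.pi * ξ * hHat ξ) * Complex.I_sq - hHat ξ * hε'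

lemma cos_mul_sub_sin_mul_ge {m : ℝ} (hm : 34 < m) (x y : ℝ) :
    ((m ^ 2 - 43) * (1 - 4 * |y|) - (m ^ 2 + 37) * (y ^ 2 / 2) * (1 + 4 * |y|)) * h x ≤
      Real.cos y * ((1 + m ^ 2) * h (x - y) - hDeriv2 (x - y)) -
        2 * Real.sin y * hDeriv (x - y) := by
  have hz := h_pos (x - y)
  have h1 := abs_le.1 (abs_hDeriv2_le (x - y))
  have h2 : |2 * Real.sin y * hDeriv (x - y)| ≤ 8 * h (x - y) := by
    rw [abs_mul, abs_mul, abs_two]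
    nlinarith [abs_hDeriv_le (x - y), Real.abs_sin_le_one y, abs_nonneg (Real.sin y),
      abs_nonneg (hDeriv (x - y))]
  have h3 := abs_le.1 h2
  have h4 : 1 - y ^ 2 / 2 ≤ Real.cos y := Real.one_sub_sq_div_two_le_cos
  have h5 : (1 - Real.cos y) * ((1 + m ^ 2) * h (x - y) - hDeriv2 (x - y)) ≤
      y ^ 2 / 2 * ((m ^ 2 + 37) * h (x - y)) := by
    refine mul_le_mul (by linarith) (by linarith) ?_ (by positivity)
    nlinarith [mul_pos (show 0 < m ^ 2 - 35 by nlinarith) hz]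
  have h6 : (m ^ 2 - 43) * ((1 - 4 * |y|) * h x) ≤ (m ^ 2 - 43) * h (x - y) :=
    mul_le_mul_of_nonneg_left (le_h_sub x y) (by nlinarith)
  have h7 : (m ^ 2 + 37) * (y ^ 2 / 2) * h (x - y) ≤
      (m ^ 2 + 37) * (y ^ 2 / 2) * ((1 + 4 * |y|) * h x) :=
    mul_le_mul_of_nonneg_left (h_sub_le x y) (by positivity)
  linarith

lemma re_resolventKernel_mul_shiftedH (m κ : ℝ) {ε : ℝ} (hε : ε ^ 2 = 1) (y z : ℝ) :
    (resolventKernel κ ε y * shiftedH m ε z).re = Real.exp (-(κ * |y|)) / (2 * κ) *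
      (Real.cos y * ((1 + m ^ 2) * h z - hDeriv2 z) - 2 * Real.sin y * hDeriv z) := by
  have hk : resolventKernel κ ε y = ((Real.exp (-(κ * |y|)) / (2 * κ) : ℝ) : ℂ) *
      Complex.exp ((-(ε * y) : ℝ) * Complex.I) := by
    rw [resolventKernel]
    push_cast
    ring
  rw [hk, mul_assoc, Complex.re_ofReal_mul, Complex.exp_ofReal_mul_I,
    shiftedH, Real.cos_neg, Real.sin_neg]
  congr 1
  simp only [Complex.mul_re, Complex.add_re, Complex.sub_re, Complex.mul_im, Complex.add_im,
    Complex.sub_im, Complex.ofReal_re, Complex.ofReal_im, Complex.I_re, Complex.I_im]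
  rcases mul_self_eq_one_iff.1 ((sq ε).symm.trans hε) with rfl | rfl
  · rw [one_mul]
    ring
  · rw [neg_one_mul, Real.cos_neg, Real.sin_neg]
    ring


lemma fourier_conj_mul_shiftedHL2 (m ε : ℝ) {S : Set ℝ} (hS : MeasurableSet S)
    (hfin : volume S ≠ ⊤) (y : ℝ) :
    𝓕 (fun ξ => (starRingEnd ℂ) (Lp.fourierTransformₗᵢ ℝ ℂ (indicatorConstLp 2 hS hfin (1 : ℂ)) ξ) *
      Lp.fourierTransformₗᵢ ℝ ℂ (shiftedHL2 m ε) ξ) y = ∫ x in S, shiftedH m ε (x - y) := by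
  have hmp := measurePreserving_sub_right (volume : Measure ℝ) y
  have hT : MemLp (fun x => shiftedHL2 m ε (x - y)) 2 volume :=
    (Lp.memLp (shiftedHL2 m ε)).comp_measurePreserving hmp
  rw [fourier_conj_mul_eq_inner_translate _ _ hT.coeFn_toLp, L2.inner_indicatorConstLp_one]
  refine integral_congr_ae (ae_restrict_of_ae ?_)
  filter_upwards [hT.coeFn_toLp, hmp.quasiMeasurePreserving.ae (shiftedHL2_coeFn m ε)] with x h1 h2
  rw [h1, h2]

lemma integrableOn_shiftedH (m ε : ℝ) {S : Set ℝ} (hfin : volume S ≠ ⊤) (y : ℝ) :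
    IntegrableOn (fun x => shiftedH m ε (x - y)) S := by
  have hL : MemLp (shiftedH m ε) 2 volume :=
    (Lp.memLp (shiftedHL2 m ε)).ae_eq (shiftedHL2_coeFn m ε)
  have hL' := hL.comp_measurePreserving (measurePreserving_sub_right (volume : Measure ℝ) y)
  have : IsFiniteMeasure (volume.restrict S) := ⟨by simpa using hfin.lt_top⟩
  exact (hL'.restrict S).integrable (by norm_num)

lemma integrableOn_h {S : Set ℝ} (hfin : volume S ≠ ⊤) : IntegrableOn h S := by
  have : IsFiniteMeasure (volume.restrict S) := ⟨by simpa using hfin.lt_top⟩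
  have := ((memLp_h.restrict S).integrable (by norm_num)).re
  simpa [IntegrableOn] using! this

/-- The lower bound for the kernel integral is a positive number. -/
lemma integral_exp_mul_lower_bound {m κ : ℝ} (hm : 34 < m) (hκ : m ≤ κ) :
    Integrable (fun y : ℝ => Real.exp (-(κ * |y|)) *
      ((m ^ 2 - 43) * (1 - 4 * |y|) - (m ^ 2 + 37) * (y ^ 2 / 2) * (1 + 4 * |y|))) ∧
    0 < ∫ y : ℝ, Real.exp (-(κ * |y|)) *
      ((m ^ 2 - 43) * (1 - 4 * |y|) - (m ^ 2 + 37) * (y ^ 2 / 2) * (1 + 4 * |y|)) := by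
  have hκ0 : 0 < κ := by linarith
  have i := integrable_pow_mul_exp_neg_abs hκ0
  have v := integral_pow_mul_exp_neg_abs hκ0
  have he : (fun y : ℝ => Real.exp (-(κ * |y|)) *
      ((m ^ 2 - 43) * (1 - 4 * |y|) - (m ^ 2 + 37) * (y ^ 2 / 2) * (1 + 4 * |y|))) =
      fun y : ℝ => ((m ^ 2 - 43) * (|y| ^ 0 * Real.exp (-(κ * |y|))) -
        (4 * (m ^ 2 - 43)) * (|y| ^ 1 * Real.exp (-(κ * |y|)))) -
        (((m ^ 2 + 37) / 2) * (|y| ^ 2 * Real.exp (-(κ * |y|))) +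
        (2 * (m ^ 2 + 37)) * (|y| ^ 3 * Real.exp (-(κ * |y|)))) := by
    ext y
    rw [← sq_abs y]
    ring
  rw [he]
  have i01 := ((i 0).const_mul (m ^ 2 - 43)).sub ((i 1).const_mul (4 * (m ^ 2 - 43)))
  have i23 := ((i 2).const_mul ((m ^ 2 + 37) / 2)).add ((i 3).const_mul (2 * (m ^ 2 + 37)))
  refine ⟨i01.sub i23, ?_⟩
  refine lt_of_lt_of_eq ?_ (integral_sub i01 i23).symm
  rw [integral_sub' ((i 0).const_mul _) ((i 1).const_mul _),
    integral_add' ((i 2).const_mul _) ((i 3).const_mul _)]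
  simp only [integral_const_mul, v]
  have e : (m ^ 2 - 43) * (2 * (Nat.factorial 0 : ℝ) / κ ^ (0 + 1)) -
      4 * (m ^ 2 - 43) * (2 * (Nat.factorial 1 : ℝ) / κ ^ (1 + 1)) -
      ((m ^ 2 + 37) / 2 * (2 * (Nat.factorial 2 : ℝ) / κ ^ (2 + 1)) +
        2 * (m ^ 2 + 37) * (2 * (Nat.factorial 3 : ℝ) / κ ^ (3 + 1))) =
      2 * ((m ^ 2 - 43) * (κ ^ 3 - 4 * κ ^ 2) - (m ^ 2 + 37) * (κ + 12)) / κ ^ 4 := by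
    simp [Nat.factorial]
    field_simp
    ring
  rw [e]
  refine div_pos ?_ (by positivity)
  have hm2 : 1156 < m ^ 2 := by nlinarith
  have h1 : (m ^ 2 + 37) * (κ + 12) ≤ (2 * (m ^ 2 - 43)) * (2 * κ) :=
    mul_le_mul (by linarith) (by linarith) (by linarith) (by linarith)
  have h2 : 4 * κ < κ ^ 3 - 4 * κ ^ 2 := by
    have : 0 < κ * (κ ^ 2 - 4 * κ - 4) := mul_pos hκ0 (by nlinarith)
    linarith
  have h3 : (m ^ 2 - 43) * (4 * κ) < (m ^ 2 - 43) * (κ ^ 3 - 4 * κ ^ 2) :=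
    mul_lt_mul_of_pos_left h2 (by linarith)
  linarith

lemma re_integral_resolvent_pos {m κ ε : ℝ} (hm : 34 < m) (hκ : m ≤ κ) (hε : ε ^ 2 = 1)
    {S : Set ℝ} (hS : MeasurableSet S) (hfin : volume S ≠ ⊤) (hS0 : volume S ≠ 0) :
    0 < (∫ ξ, ((starRingEnd ℂ)
      (Lp.fourierTransformₗᵢ ℝ ℂ (indicatorConstLp 2 hS hfin (1 : ℂ)) ξ) *
      Lp.fourierTransformₗᵢ ℝ ℂ (shiftedHL2 m ε) ξ) *
        (((2 * Real.pi * ξ + ε) ^ 2 + κ ^ 2 : ℝ) : ℂ)⁻¹).re := by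
  have hκ0 : 0 < κ := by linarith
  set p : ℝ → ℂ := fun ξ => (starRingEnd ℂ)
      (Lp.fourierTransformₗᵢ ℝ ℂ (indicatorConstLp 2 hS hfin (1 : ℂ)) ξ) *
      Lp.fourierTransformₗᵢ ℝ ℂ (shiftedHL2 m ε) ξ with hp
  have hpi : Integrable p := integrable_conj_mul _ _
  have hki := integrable_resolventKernel hκ0 ε
  have h1 : ∫ ξ, p ξ * (((2 * Real.pi * ξ + ε) ^ 2 + κ ^ 2 : ℝ) : ℂ)⁻¹ =
      ∫ y, resolventKernel κ ε y * 𝓕 p y := by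
    rw [← integral_fourier_mul_L1 hki hpi]
    refine integral_congr_ae (Filter.Eventually.of_forall fun ξ => ?_)
    simp only [fourier_resolventKernel hκ0]
    ring
  have hint := integrable_mul_fourier hki hpi
  obtain ⟨hbi, hbpos⟩ := integral_exp_mul_lower_bound hm hκ
  have hre := integral_re hint
  simp only [RCLike.re_to_complex] at hre
  rw [h1, ← hre]
  have hc : 0 < ∫ x in S, h x := by
    rw [setIntegral_pos_iff_support_of_nonneg_ae
      (Filter.Eventually.of_forall fun x => (h_pos x).le) (integrableOn_h hfin)]
    have : Function.support h = Set.univ := Set.eq_univ_of_forall fun x => (h_pos x).ne'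
    rw [this, Set.univ_inter]
    exact pos_iff_ne_zero.2 hS0
  refine lt_of_lt_of_le (mul_pos (mul_pos (one_div_pos.2 (mul_pos two_pos hκ0)) hc) hbpos) ?_
  rw [← integral_const_mul]
  refine integral_mono (hbi.const_mul _) hint.re fun y => ?_
  have hF : 𝓕 p y = ∫ x in S, shiftedH m ε (x - y) := fourier_conj_mul_shiftedHL2 m ε hS hfin y
  have hi := (integrableOn_shiftedH m ε hfin y).const_mul (resolventKernel κ ε y)
  have hre' := integral_re hi
  simp only [RCLike.re_to_complex] at hre' ⊢
  have h3 : resolventKernel κ ε y * ∫ x in S, shiftedH m ε (x - y) =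
      ∫ x in S, resolventKernel κ ε y * shiftedH m ε (x - y) := (integral_const_mul _ _).symm
  rw [hF, h3, ← hre']
  have h2 : 1 / (2 * κ) * (∫ x in S, h x) * (Real.exp (-(κ * |y|)) *
      ((m ^ 2 - 43) * (1 - 4 * |y|) - (m ^ 2 + 37) * (y ^ 2 / 2) * (1 + 4 * |y|))) =
      ∫ x in S, (Real.exp (-(κ * |y|)) / (2 * κ) *
      ((m ^ 2 - 43) * (1 - 4 * |y|) - (m ^ 2 + 37) * (y ^ 2 / 2) * (1 + 4 * |y|))) * h x := by
    rw [integral_const_mul]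
    ring
  rw [h2]
  refine integral_mono ((integrableOn_h hfin).const_mul _) hi.re fun x => ?_
  beta_reduce
  rw [re_resolventKernel_mul_shiftedH m κ hε, mul_assoc]
  exact mul_le_mul_of_nonneg_left (cos_mul_sub_sin_mul_ge hm x y) (by positivity)

lemma re_inner_sqrt_shift_pos {m ε : ℝ} (hm : 34 < m) (hε : ε ^ 2 = 1) {ψ : L2 ℝ}
    (hψ : Lp.fourierTransformₗᵢ ℝ ℂ ψ =ᵐ[volume]
      fun ξ => (√((2 * Real.pi * ξ + ε) ^ 2 + m ^ 2) : ℂ) * hHat ξ)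
    {S : Set ℝ} (hS : MeasurableSet S) (hfin : volume S ≠ ⊤) (hS0 : volume S ≠ 0) :
    0 < (inner ℂ (indicatorConstLp 2 hS hfin (1 : ℂ)) ψ).re := by
  have hm0 : 0 < m := by linarith
  have hsq : ∀ ξ : ℝ, √((2 * Real.pi * ξ + ε) ^ 2 + m ^ 2) ^ 2 = (2 * Real.pi * ξ + ε) ^ 2 + m ^ 2 :=
    fun ξ => Real.sq_sqrt (by positivity)
  have key := re_integral_mul_inv_pos
    (integrable_conj_mul (Lp.fourierTransformₗᵢ ℝ ℂ (indicatorConstLp 2 hS hfin (1 : ℂ)))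
      (Lp.fourierTransformₗᵢ ℝ ℂ (shiftedHL2 m ε)))
    (a := fun ξ => √((2 * Real.pi * ξ + ε) ^ 2 + m ^ 2)) (by fun_prop) hm0
    (fun ξ => Real.le_sqrt_of_sq_le (by nlinarith [sq_nonneg (2 * Real.pi * ξ + ε)]))
    (fun s hs => by
      have hκ : m ≤ √(m ^ 2 + s ^ 2) := Real.le_sqrt_of_sq_le (by nlinarith)
      have := re_integral_resolvent_pos hm hκ hε hS hfin hS0
      rw [Real.sq_sqrt (by positivity)] at this
      simpa only [hsq, add_assoc] using this)
  rw [← (Lp.fourierTransformₗᵢ ℝ ℂ).inner_map_map, L2.inner_def]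
  convert key using 2
  refine integral_congr_ae ?_
  filter_upwards [hψ, fourier_shiftedHL2 m hε] with ξ h1 h2
  have h3 : (√((2 * Real.pi * ξ + ε) ^ 2 + m ^ 2) : ℂ) ≠ 0 := by
    have : 0 < √((2 * Real.pi * ξ + ε) ^ 2 + m ^ 2) := Real.sqrt_pos.2 (by positivity)
    exact_mod_cast this.ne'
  have h4 : (((2 * Real.pi * ξ + ε) ^ 2 + m ^ 2 : ℝ) : ℂ) =
      (√((2 * Real.pi * ξ + ε) ^ 2 + m ^ 2) : ℂ) ^ 2 := by
    rw [← Complex.ofReal_pow, hsq]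
  rw [RCLike.inner_apply', h1, h2, h4]
  field_simp

end MosesTuan

section Symmetry

variable {E : Type*} [NormedAddCommGroup E] [InnerProductSpace ℝ E] [FiniteDimensional ℝ E]
  [MeasurableSpace E] [BorelSpace E]

theorem ae_comp_neg {P : E → Prop} (h : ∀ᵐ x : E, P x) : ∀ᵐ x : E, P (-x) :=
  (Measure.measurePreserving_neg (volume : Measure E)).quasiMeasurePreserving.ae h

theorem memLp_comp_neg (ψ : L2 E) : MemLp (fun x => ψ (-x)) 2 volume :=
  (Lp.memLp ψ).comp_measurePreserving (Measure.measurePreserving_neg _)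

/-- Parity is invariant under the Fourier transform. -/
theorem fourier_parity_iff (c : ℂ) (ψ : L2 E) :
    (∀ᵐ ξ, Lp.fourierTransformₗᵢ E ℂ ψ (-ξ) = c * Lp.fourierTransformₗᵢ E ℂ ψ ξ) ↔
      ∀ᵐ x, ψ (-x) = c * ψ x := by
  have h1 := (memLp_comp_neg ψ).coeFn_toLp
  have h2 := fourier_reflect h1
  set ψ' := (memLp_comp_neg ψ).toLp with hψ'
  have h3 := Lp.coeFn_smul c (Lp.fourierTransformₗᵢ E ℂ ψ)
  have h4 := Lp.coeFn_smul c ψ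
  rw [← map_smul] at h3
  constructor
  · intro h
    have : ψ' = c • ψ := by
      refine (Lp.fourierTransformₗᵢ E ℂ).injective (Lp.ext ?_)
      filter_upwards [h, h2, h3] with ξ a1 a2 a3
      rw [a2, a3, a1]; rfl
    rw [this] at h1
    filter_upwards [h1, h4] with x a1 a2
    rw [← a1, a2]; rfl
  · intro h
    have : ψ' = c • ψ := by
      refine Lp.ext ?_
      filter_upwards [h, h1, h4] with x a1 a2 a3
      rw [a2, a3, a1]; rfl
    rw [this] at h2
    filter_upwards [h2, h3] with x a1 a2
    rw [← a1, a2]; rfl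

open ComplexConjugate in
/-- A function is real if and only if its Fourier transform is Hermitian. -/
theorem fourier_hermitian_iff (ψ : L2 E) :
    (∀ᵐ ξ, conj (Lp.fourierTransformₗᵢ E ℂ ψ (-ξ)) = Lp.fourierTransformₗᵢ E ℂ ψ ξ) ↔
      ∀ᵐ x, conj (ψ x) = ψ x := by
  have hm : MemLp (fun x => conj (ψ x)) 2 volume := (Lp.memLp ψ).star
  have h1 := hm.coeFn_toLp
  have h2 := fourier_conj h1
  set ψ' := hm.toLp with hψ'
  constructor
  · intro h
    have : ψ' = ψ := by
      refine (Lp.fourierTransformₗᵢ E ℂ).injective (Lp.ext ?_)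
      filter_upwards [h, h2] with ξ a1 a2
      rw [a2, a1]
    rw [this] at h1
    filter_upwards [h1] with x a1
    rw [← a1]
  · intro h
    have : ψ' = ψ := by
      refine Lp.ext ?_
      filter_upwards [h, h1] with x a1 a2
      rw [a2, a1]
    rw [this] at h2
    filter_upwards [h2] with x a1
    rw [← a1]

open ComplexConjugate in
/-- Multipliers with an even real symbol preserve reality. -/
theorem conj_eq_of_fourier_eq_even_mul {σ : E → ℝ} (hσ : ∀ ξ, σ (-ξ) = σ ξ) {ψ χ : L2 E}
    (hχ : Lp.fourierTransformₗᵢ E ℂ χ =ᵐ[volume] fun ξ => (σ ξ : ℂ) * Lp.fourierTransformₗᵢ E ℂ ψ ξ)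
    (hψ : ∀ᵐ x, conj (ψ x) = ψ x) : ∀ᵐ x, conj (χ x) = χ x := by
  rw [← fourier_hermitian_iff] at hψ ⊢
  filter_upwards [hψ, hχ, ae_comp_neg hχ] with ξ h1 h2 h3
  rw [h2, h3, hσ, map_mul, Complex.conj_ofReal, h1]

/-- Multipliers with an even symbol preserve parity. -/
theorem parity_of_fourier_eq_even_mul {σ : E → ℝ} (hσ : ∀ ξ, σ (-ξ) = σ ξ) {ψ χ : L2 E} {c : ℂ}
    (hχ : Lp.fourierTransformₗᵢ E ℂ χ =ᵐ[volume] fun ξ => (σ ξ : ℂ) * Lp.fourierTransformₗᵢ E ℂ ψ ξ)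
    (hψ : ∀ᵐ x, ψ (-x) = c * ψ x) : ∀ᵐ x, χ (-x) = c * χ x := by
  rw [← fourier_parity_iff] at hψ ⊢
  filter_upwards [hψ, hχ, ae_comp_neg hχ] with ξ h1 h2 h3
  rw [h2, h3, hσ, h1]
  ring

end Symmetry

namespace MosesTuan

lemma sqrt_shift_le (m k : ℝ) {ε : ℝ} (hε : ε ^ 2 = 1) :
    √((k + ε) ^ 2 + m ^ 2) ≤ |k| + 1 + |m| := by
  have h1 : |ε| = 1 := by rw [← sq_abs] at hε; nlinarith [abs_nonneg ε]
  have h2 : |k + ε| ≤ |k| + 1 := h1 ▸ abs_add_le k ε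
  refine Real.sqrt_le_iff.2 ⟨by positivity, ?_⟩
  rw [← sq_abs (k + ε), ← sq_abs m]
  nlinarith [abs_nonneg (k + ε), abs_nonneg m, abs_nonneg k,
    mul_nonneg (add_nonneg (abs_nonneg k) zero_le_one) (abs_nonneg m)]

lemma memLp_sqrt_shift_mul_hHat (m : ℝ) {ε : ℝ} (hε : ε ^ 2 = 1) :
    MemLp (fun ξ : ℝ => (√((2 * Real.pi * ξ + ε) ^ 2 + m ^ 2) : ℂ) * hHat ξ) 2 volume := by
  refine memLp_mul_hHat (σ := fun k => √((k + ε) ^ 2 + m ^ 2)) (by fun_prop) (C := 2 + |m|)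
    fun k => ?_
  rw [abs_of_nonneg (Real.sqrt_nonneg _)]
  refine (sqrt_shift_le m k hε).trans ?_
  nlinarith [sq_abs k, sq_nonneg (|k| - 1), abs_nonneg m, mul_nonneg (abs_nonneg m) (sq_nonneg k)]

lemma hL2_mem_domain_add (m : ℝ) :
    hL2 ∈ (momentumOp (fun k : ℝ => √((k + 1) ^ 2 + m ^ 2))).domain :=
  memLp_sqrt_shift_mul_hHat m (one_pow 2)

lemma hL2_mem_domain_sub (m : ℝ) :
    hL2 ∈ (momentumOp (fun k : ℝ => √((k - 1) ^ 2 + m ^ 2))).domain := by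
  have := memLp_sqrt_shift_mul_hHat m (ε := -1) (by norm_num)
  simp only [← sub_eq_add_neg] at this
  exact this

lemma hL2_mem_domain (m : ℝ) : hL2 ∈ (shiftOp m).domain :=
  ⟨hL2_mem_domain_add m, hL2_mem_domain_sub m⟩

lemma f_eq (m : ℝ) : f m = momentumOp (fun k : ℝ => √((k + 1) ^ 2 + m ^ 2))
      ⟨hL2, hL2_mem_domain_add m⟩ +
    momentumOp (fun k : ℝ => √((k - 1) ^ 2 + m ^ 2)) ⟨hL2, hL2_mem_domain_sub m⟩ :=
  opValue_of_mem (hL2_mem_domain m)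

/-- The symbol defining `f̃`, on the Fourier side. -/
def shiftSymbol (m ξ : ℝ) : ℝ :=
  √((2 * Real.pi * ξ + 1) ^ 2 + m ^ 2) + √((2 * Real.pi * ξ - 1) ^ 2 + m ^ 2)

lemma fourier_f (m : ℝ) : Lp.fourierTransformₗᵢ ℝ ℂ (f m) =ᵐ[volume]
    fun ξ => (shiftSymbol m ξ : ℂ) * hHat ξ := by
  rw [f_eq, map_add]
  refine (Lp.coeFn_add _ _).trans ?_
  filter_upwards [fourier_momentumOp (fun k : ℝ => √((k + 1) ^ 2 + m ^ 2))
      ⟨hL2, hL2_mem_domain_add m⟩, fourier_momentumOp (fun k : ℝ => √((k - 1) ^ 2 + m ^ 2))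
      ⟨hL2, hL2_mem_domain_sub m⟩] with ξ h1 h2
  rw [Pi.add_apply, h1, h2, shiftSymbol, smul_eq_mul, Complex.ofReal_add, add_mul]
  rfl

lemma re_f_pos {m : ℝ} (hm : 34 < m) : ∀ᵐ x : ℝ, 0 < (f m x).re := by
  by_contra hcon
  have hmeas : Measurable fun x => (f m x).re :=
    Complex.measurable_re.comp (Lp.stronglyMeasurable (f m)).measurable
  have hS0 : MeasurableSet {x | ¬ 0 < (f m x).re} :=
    (measurableSet_lt measurable_const hmeas).compl
  obtain ⟨n, hn⟩ : ∃ n : ℕ, volume ({x | ¬ 0 < (f m x).re} ∩ Set.Icc (-n : ℝ) n) ≠ 0 := by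
    by_contra! h
    refine hcon (ae_iff.2 (measure_mono_null (fun x hx => ?_) (measure_iUnion_null h)))
    obtain ⟨n, hn⟩ := exists_nat_ge |x|
    exact Set.mem_iUnion.2 ⟨n, not_lt.1 hx, abs_le.1 hn⟩
  set S := {x | ¬ 0 < (f m x).re} ∩ Set.Icc (-n : ℝ) n with hS
  have hSm : MeasurableSet S := hS0.inter measurableSet_Icc
  have hfin : volume S ≠ ⊤ :=
    ((measure_mono Set.inter_subset_right).trans_lt measure_Icc_lt_top).ne
  have h1 := re_inner_sqrt_shift_pos hm (one_pow 2) (m := m)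
    (ψ := momentumOp (fun k : ℝ => √((k + 1) ^ 2 + m ^ 2)) ⟨hL2, hL2_mem_domain_add m⟩)
    (fourier_momentumOp _ _) hSm hfin hn
  have h2 := re_inner_sqrt_shift_pos hm (ε := -1) (by norm_num) (m := m)
    (ψ := momentumOp (fun k : ℝ => √((k - 1) ^ 2 + m ^ 2)) ⟨hL2, hL2_mem_domain_sub m⟩)
    (by
      simp only [← sub_eq_add_neg]
      exact fourier_momentumOp _ _) hSm hfin hn
  have h3 : 0 < (inner ℂ (indicatorConstLp 2 hSm hfin (1 : ℂ)) (f m)).re := by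
    rw [f_eq, inner_add_right, Complex.add_re]
    exact add_pos h1 h2
  rw [L2.inner_indicatorConstLp_one] at h3
  have : IsFiniteMeasure (volume.restrict S) := ⟨by simpa using hfin.lt_top⟩
  have hi : Integrable (f m) (volume.restrict S) :=
    ((Lp.memLp (f m)).restrict S).integrable (by norm_num)
  have h4 := integral_re hi
  simp only [RCLike.re_to_complex] at h4
  rw [← h4] at h3
  exact absurd h3 (not_lt.2 (setIntegral_nonpos hSm fun x hx => not_lt.1 hx.1))

lemma shiftSymbol_neg (m ξ : ℝ) : shiftSymbol m (-ξ) = shiftSymbol m ξ := by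
  unfold shiftSymbol
  rw [add_comm]
  congr 3 <;> ring

open ComplexConjugate in
lemma conj_f (m : ℝ) : ∀ᵐ x : ℝ, conj (f m x) = f m x := by
  refine conj_eq_of_fourier_eq_even_mul (shiftSymbol_neg m) (ψ := hL2) (fourier_f m) ?_
  filter_upwards [memLp_h.coeFn_toLp] with x hx
  rw [hL2, hx, Complex.conj_ofReal]

lemma f_neg (m : ℝ) : ∀ᵐ x : ℝ, f m (-x) = 1 * f m x := by
  refine parity_of_fourier_eq_even_mul (shiftSymbol_neg m) (ψ := hL2) (fourier_f m) ?_
  filter_upwards [memLp_h.coeFn_toLp, ae_comp_neg memLp_h.coeFn_toLp] with x h1 h2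
  rw [hL2, h1, h2, one_mul, h, h, abs_neg]

lemma u_coeFn (m : ℝ) : u m =ᵐ[volume] fun x => f m x * (Real.sin x : ℂ) :=
  (memLp_f_mul_sin m).coeFn_toLp

lemma u_ne_zero {m : ℝ} (hm : 34 < m) : ∀ᵐ x : ℝ, u m x ≠ 0 := by
  have hsin : ∀ᵐ x : ℝ, Real.sin x ≠ 0 := by
    have hc : {x : ℝ | ¬ Real.sin x ≠ 0}.Countable := by
      refine (Set.countable_range fun n : ℤ => (n : ℝ) * Real.pi).mono fun x hx => ?_
      exact Real.sin_eq_zero_iff.1 (not_not.1 hx)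
    exact ae_iff.2 (hc.measure_zero _)
  filter_upwards [u_coeFn m, re_f_pos hm, hsin] with x h1 h2 h3
  rw [h1]
  refine mul_ne_zero (fun h => ?_) (by exact_mod_cast h3)
  rw [h] at h2
  simp at h2

open ComplexConjugate in
lemma conj_u (m : ℝ) : ∀ᵐ x : ℝ, conj (u m x) = u m x := by
  filter_upwards [u_coeFn m, conj_f m] with x h1 h2
  rw [h1, map_mul, h2, Complex.conj_ofReal]

lemma u_neg (m : ℝ) : ∀ᵐ x : ℝ, u m (-x) = -1 * u m x := by
  filter_upwards [u_coeFn m, ae_comp_neg (u_coeFn m), f_neg m] with x h1 h2 h3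
  rw [h1, h2, h3, Real.sin_neg]
  push_cast
  ring

lemma memLp_modulate_f (m ε : ℝ) :
    MemLp (fun x : ℝ => Complex.exp ((2 * Real.pi * (ε / (2 * Real.pi)) * x : ℝ) * Complex.I) * f m x)
      2 volume := by
  refine (Lp.memLp (f m)).of_le
    ((Continuous.aestronglyMeasurable (by fun_prop)).mul (Lp.aestronglyMeasurable _))
    (Filter.Eventually.of_forall fun x => ?_)
  rw [norm_mul, Complex.norm_exp_ofReal_mul_I, one_mul]

lemma memLp_kinetic_modulate_f (m : ℝ) {ε : ℝ} (hε : ε ^ 2 = 1) :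
    MemLp (fun ξ : ℝ => ((√((2 * Real.pi * ξ) ^ 2 + m ^ 2) - m : ℝ) : ℂ) *
      Lp.fourierTransformₗᵢ ℝ ℂ (memLp_modulate_f m ε).toLp ξ) 2 volume := by
  have h0 : MemLp (fun ξ : ℝ => (((√((2 * Real.pi * ξ + ε) ^ 2 + m ^ 2) - m) *
      shiftSymbol m ξ : ℝ) : ℂ) * hHat ξ) 2 volume := by
    refine memLp_mul_hHat (σ := fun k => (√((k + ε) ^ 2 + m ^ 2) - m) *
      (√((k + 1) ^ 2 + m ^ 2) + √((k - 1) ^ 2 + m ^ 2))) (by fun_prop)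
      (C := 8 * (1 + |m|) ^ 2) fun k => ?_
    have b0 := sqrt_shift_le m k hε
    have b1 := sqrt_shift_le m k (one_pow 2)
    have b2 := sqrt_shift_le m k (ε := -1) (by norm_num)
    rw [← sub_eq_add_neg] at b2
    have c0 : |√((k + ε) ^ 2 + m ^ 2) - m| ≤ 2 * (|k| + 1 + |m|) := by
      refine (abs_sub _ _).trans ?_
      rw [abs_of_nonneg (Real.sqrt_nonneg _)]
      linarith [abs_nonneg k]
    have c1 : |√((k + 1) ^ 2 + m ^ 2) + √((k - 1) ^ 2 + m ^ 2)| ≤ 2 * (|k| + 1 + |m|) := by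
      rw [abs_of_nonneg (by positivity)]
      linarith
    rw [abs_mul]
    refine (mul_le_mul c0 c1 (abs_nonneg _) (by positivity)).trans ?_
    rw [← sq_abs k]
    nlinarith [sq_nonneg (|k| - (1 + |m|)), abs_nonneg k, abs_nonneg m,
      mul_nonneg (sq_nonneg |k|) (abs_nonneg m), sq_nonneg (|k| * |m|)]
  have h1 := h0.comp_measurePreserving
    (measurePreserving_sub_right (volume : Measure ℝ) (ε / (2 * Real.pi)))
  refine h1.ae_eq ?_
  filter_upwards [fourier_modulate (ε / (2 * Real.pi)) (memLp_modulate_f m ε).coeFn_toLp,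
    (measurePreserving_sub_right (volume : Measure ℝ) (ε / (2 * Real.pi))).quasiMeasurePreserving.ae
      (fourier_f m)] with ξ a1 a2
  have e : 2 * Real.pi * (ξ - ε / (2 * Real.pi)) + ε = 2 * Real.pi * ξ := by
    field_simp
    ring
  rw [a1, a2, Function.comp_apply, e]
  push_cast
  ring

lemma u_mem_domain (m : ℝ) : u m ∈ (relKinetic ℝ m).domain := by
  change MemLp (fun ξ : ℝ => ((√(‖(2 * Real.pi) • ξ‖ ^ 2 + m ^ 2) - m : ℝ) : ℂ) *
    Lp.fourierTransformₗᵢ ℝ ℂ (u m) ξ) 2 volume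
  have hu : u m = (1 / (2 * Complex.I)) • ((memLp_modulate_f m 1).toLp -
      (memLp_modulate_f m (-1)).toLp) := by
    refine Lp.ext ?_
    filter_upwards [u_coeFn m, Lp.coeFn_smul (1 / (2 * Complex.I)) ((memLp_modulate_f m 1).toLp -
      (memLp_modulate_f m (-1)).toLp), Lp.coeFn_sub (memLp_modulate_f m 1).toLp
      (memLp_modulate_f m (-1)).toLp, (memLp_modulate_f m 1).coeFn_toLp,
      (memLp_modulate_f m (-1)).coeFn_toLp] with x h1 h2 h3 h4 h5
    rw [h1, h2, Pi.smul_apply, h3, Pi.sub_apply, h4, h5]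
    have e1 : 2 * Real.pi * (1 / (2 * Real.pi)) * x = x := by field_simp
    have e2 : 2 * Real.pi * (-1 / (2 * Real.pi)) * x = -x := by field_simp
    rw [e1, e2, Complex.exp_ofReal_mul_I, Complex.exp_ofReal_mul_I, Real.cos_neg, Real.sin_neg,
      smul_eq_mul]
    push_cast
    field_simp
    ring
  rw [hu, map_smul, map_sub]
  set A := Lp.fourierTransformₗᵢ ℝ ℂ (memLp_modulate_f m 1).toLp with hA
  set B := Lp.fourierTransformₗᵢ ℝ ℂ (memLp_modulate_f m (-1)).toLp with hB
  refine (((memLp_kinetic_modulate_f m (one_pow 2)).sub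
    (memLp_kinetic_modulate_f m (ε := -1) (by norm_num))).const_mul (1 / (2 * Complex.I))).ae_eq ?_
  filter_upwards [Lp.coeFn_smul (1 / (2 * Complex.I)) (A - B), Lp.coeFn_sub A B] with ξ h1 h2
  rw [h1, Pi.smul_apply, h2, Pi.sub_apply, Pi.sub_apply, smul_eq_mul, Real.norm_eq_abs, sq_abs,
    smul_eq_mul]
  ring

/-- The function `(√(p² + m²) - m) ũ`. -/
def kineticU (m : ℝ) : L2 ℝ := opValue (relKinetic ℝ m) (u m)

lemma fourier_kineticU (m : ℝ) : Lp.fourierTransformₗᵢ ℝ ℂ (kineticU m) =ᵐ[volume]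
    fun ξ => ((√(|2 * Real.pi * ξ| ^ 2 + m ^ 2) - m : ℝ) : ℂ) *
      Lp.fourierTransformₗᵢ ℝ ℂ (u m) ξ := by
  rw [kineticU, opValue_of_mem (u_mem_domain m)]
  exact fourier_momentumOp _ _

open ComplexConjugate in
lemma conj_kineticU (m : ℝ) : ∀ᵐ x : ℝ, conj (kineticU m x) = kineticU m x :=
  conj_eq_of_fourier_eq_even_mul (fun ξ => by rw [mul_neg, abs_neg]) (fourier_kineticU m) (conj_u m)

lemma kineticU_neg (m : ℝ) : ∀ᵐ x : ℝ, kineticU m (-x) = -1 * kineticU m x :=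
  parity_of_fourier_eq_even_mul (fun ξ => by rw [mul_neg, abs_neg]) (fourier_kineticU m) (u_neg m)

lemma V_im (m : ℝ) : ∀ᵐ x : ℝ, (V m x).im = 0 := by
  filter_upwards [conj_u m, conj_kineticU m] with x h1 h2
  refine Complex.conj_eq_iff_im.1 ?_
  rw [V, map_sub, map_div₀, Complex.conj_ofReal, h1]
  congr 2

end MosesTuan

section Radial

theorem quasiMeasurePreserving_norm :
    Measure.QuasiMeasurePreserving (fun x : EuclideanSpace ℝ (Fin 3) => ‖x‖) volume volume := by
  refine ⟨measurable_norm, Measure.AbsolutelyContinuous.mk fun s hs h0 => ?_⟩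
  rw [Measure.map_apply measurable_norm hs]
  have hz : (fun y : ℝ => y ^ (Module.finrank ℝ (EuclideanSpace ℝ (Fin 3)) - 1) •
      s.indicator (1 : ℝ → ℝ) y) =ᵐ[volume] 0 := by
    filter_upwards [measure_eq_zero_iff_ae_notMem.1 h0] with y hy
    simp [hy]
  have hi := (integrable_fun_norm_addHaar (volume : Measure (EuclideanSpace ℝ (Fin 3)))
    (f := s.indicator (1 : ℝ → ℝ))).2
      (((integrable_zero ℝ ℝ volume).congr hz.symm).integrableOn)
  have h1 := integral_fun_norm_addHaar (volume : Measure (EuclideanSpace ℝ (Fin 3)))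
    (s.indicator (1 : ℝ → ℝ))
  rw [integral_congr_ae (ae_restrict_of_ae hz)] at h1
  simp only [Pi.zero_apply, integral_zero, smul_zero] at h1
  have h2 := (integral_eq_zero_iff_of_nonneg
    (fun x => Set.indicator_nonneg (fun _ _ => zero_le_one) _) hi).1 h1
  rw [measure_eq_zero_iff_ae_notMem]
  filter_upwards [h2] with x hx hxs
  simp [Set.indicator_of_mem (Set.mem_preimage.1 hxs)] at hx

/-- The radial function on `ℝ³` with reduced profile `φ`. -/
def radialFun (φ : ℝ → ℂ) (x : EuclideanSpace ℝ (Fin 3)) : ℂ :=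
  φ ‖x‖ / ((√(4 * Real.pi) * ‖x‖ : ℝ) : ℂ)

theorem radialFun_congr {φ χ : ℝ → ℂ} (h : φ =ᵐ[volume] χ) :
    radialFun φ =ᵐ[volume] radialFun χ := by
  filter_upwards [quasiMeasurePreserving_norm.ae h] with x hx
  rw [radialFun, radialFun, hx]

theorem norm_radialFun_sq (φ : ℝ → ℂ) (x : EuclideanSpace ℝ (Fin 3)) :
    ‖radialFun φ x‖ ^ 2 = ‖φ ‖x‖‖ ^ 2 / (4 * Real.pi * ‖x‖ ^ 2) := by
  rw [radialFun, norm_div, Complex.norm_real, Real.norm_of_nonneg (by positivity), div_pow, mul_pow,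
    Real.sq_sqrt (by positivity)]

theorem radial_weight (φ : ℝ → ℂ) : Set.EqOn
    (fun y : ℝ => y ^ (Module.finrank ℝ (EuclideanSpace ℝ (Fin 3)) - 1) •
      (‖φ y‖ ^ 2 / (4 * Real.pi * y ^ 2))) (fun y => ‖φ y‖ ^ 2 / (4 * Real.pi)) (Set.Ioi 0) := by
  intro y hy
  have hy0 : y ≠ 0 := (Set.mem_Ioi.1 hy).ne'
  simp only [finrank_euclideanSpace, Fintype.card_fin, smul_eq_mul]
  field_simp
  simp only [Nat.add_one_sub_one]
  ring

theorem memLp_radialFun {φ : ℝ → ℂ} (h : MemLp φ 2 volume) : MemLp (radialFun φ) 2 volume := by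
  have hm : AEStronglyMeasurable (radialFun φ) volume := by
    have h1 := h.aestronglyMeasurable.comp_quasiMeasurePreserving quasiMeasurePreserving_norm
    have h2 : Measurable fun x : EuclideanSpace ℝ (Fin 3) =>
        (((√(4 * Real.pi) * ‖x‖ : ℝ) : ℂ))⁻¹ := by fun_prop
    refine (h1.mul h2.aestronglyMeasurable).congr (Filter.Eventually.of_forall fun x => ?_)
    simp [radialFun, div_eq_mul_inv]
  rw [memLp_two_iff_integrable_sq_norm hm]
  simp only [norm_radialFun_sq]
  rw [integrable_fun_norm_addHaar volume (f := fun y => ‖φ y‖ ^ 2 / (4 * Real.pi * y ^ 2)),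
    integrableOn_congr_fun (radial_weight φ) measurableSet_Ioi]
  exact (((memLp_two_iff_integrable_sq_norm h.aestronglyMeasurable).1 h).div_const _).integrableOn

theorem L2_norm_sq {E : Type*} [NormedAddCommGroup E] [InnerProductSpace ℝ E]
    [FiniteDimensional ℝ E] [MeasurableSpace E] [BorelSpace E] (ψ : L2 E) :
    ‖ψ‖ ^ 2 = ∫ x, ‖ψ x‖ ^ 2 := by
  have h := inner_self_eq_norm_sq_to_K (𝕜 := ℂ) ψ
  rw [L2.inner_def] at h
  simp only [inner_self_eq_norm_sq_to_K] at h
  have h2 : ∫ x, ((‖ψ x‖ : ℂ)) ^ 2 = ((∫ x, ‖ψ x‖ ^ 2 : ℝ) : ℂ) := by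
    rw [← integral_complex_ofReal]
    simp
  apply Complex.ofReal_injective
  rw [← h2, Complex.ofReal_pow]
  exact h.symm

theorem norm_radialFun_toLp_sq_le (φ : L2 ℝ) : ‖(memLp_radialFun (Lp.memLp φ)).toLp‖ ^ 2 ≤
    (3 * volume.real (Metric.ball (0 : EuclideanSpace ℝ (Fin 3)) 1) / (4 * Real.pi)) * ‖φ‖ ^ 2 := by
  rw [L2_norm_sq, L2_norm_sq]
  have hi : Integrable fun y => ‖φ y‖ ^ 2 :=
    (memLp_two_iff_integrable_sq_norm (Lp.aestronglyMeasurable φ)).1 (Lp.memLp φ)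
  have h1 : ∫ x, ‖(memLp_radialFun (Lp.memLp φ)).toLp (radialFun φ) x‖ ^ 2 =
      ∫ x : EuclideanSpace ℝ (Fin 3), ‖φ ‖x‖‖ ^ 2 / (4 * Real.pi * ‖x‖ ^ 2) := by
    refine integral_congr_ae ?_
    filter_upwards [(memLp_radialFun (Lp.memLp φ)).coeFn_toLp] with x hx
    rw [hx, norm_radialFun_sq]
  rw [h1, integral_fun_norm_addHaar volume (fun y => ‖φ y‖ ^ 2 / (4 * Real.pi * y ^ 2)),
    setIntegral_congr_fun measurableSet_Ioi (radial_weight φ), integral_div]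
  simp only [finrank_euclideanSpace, Fintype.card_fin, nsmul_eq_mul, smul_eq_mul]
  have h2 : ∫ y in Set.Ioi (0 : ℝ), ‖φ y‖ ^ 2 ≤ ∫ y, ‖φ y‖ ^ 2 :=
    setIntegral_le_integral hi (Filter.Eventually.of_forall fun y => by positivity)
  calc _ = (3 * volume.real (Metric.ball (0 : EuclideanSpace ℝ (Fin 3)) 1) / (4 * Real.pi)) *
        ∫ y in Set.Ioi (0 : ℝ), ‖φ y‖ ^ 2 := by push_cast; ring
    _ ≤ _ := by gcongr

/-- The map sending a reduced profile on the line to the corresponding radial function. -/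
def radialLift : L2 ℝ →L[ℂ] L2 (EuclideanSpace ℝ (Fin 3)) :=
  LinearMap.mkContinuous
    { toFun := fun φ => (memLp_radialFun (Lp.memLp φ)).toLp
      map_add' := by
        intro a b
        rw [← MemLp.toLp_add]
        apply MemLp.toLp_congr
        filter_upwards [radialFun_congr (Lp.coeFn_add a b)] with x hx
        rw [hx]
        simp [radialFun, add_div]
      map_smul' := by
        intro c a
        rw [RingHom.id_apply, ← MemLp.toLp_const_smul]
        apply MemLp.toLp_congr
        filter_upwards [radialFun_congr (Lp.coeFn_smul c a)] with x hx
        rw [hx]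
        simp [radialFun, mul_div_assoc] }
    (√(3 * volume.real (Metric.ball (0 : EuclideanSpace ℝ (Fin 3)) 1) / (4 * Real.pi)))
    (fun φ => by
      refine (pow_le_pow_iff_left₀ (norm_nonneg _) (by positivity) two_ne_zero).1 ?_
      rw [mul_pow, Real.sq_sqrt (by positivity)]
      exact norm_radialFun_toLp_sq_le φ)

theorem radialLift_coeFn (φ : L2 ℝ) : radialLift φ =ᵐ[volume] radialFun φ :=
  (memLp_radialFun (Lp.memLp φ)).coeFn_toLp

theorem integrable_gaussian {E : Type*} [NormedAddCommGroup E] [InnerProductSpace ℝ E]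
    [FiniteDimensional ℝ E] [MeasurableSpace E] [BorelSpace E] {b : ℂ} (hb : 0 < b.re) :
    Integrable fun x : E => Complex.exp (-b * ‖x‖ ^ 2) := by
  simpa using GaussianFourier.integrable_cexp_neg_mul_sq_norm_add hb 0 (0 : E)

theorem norm_gaussian (b : ℂ) (r : ℝ) :
    ‖Complex.exp (-b * r ^ 2)‖ = Real.exp (-b.re * r ^ 2) := by
  rw [Complex.norm_exp, ← Complex.ofReal_pow, Complex.re_mul_ofReal, Complex.neg_re]

theorem memLp_gaussian {E : Type*} [NormedAddCommGroup E] [InnerProductSpace ℝ E]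
    [FiniteDimensional ℝ E] [MeasurableSpace E] [BorelSpace E] {b : ℂ} (hb : 0 < b.re) :
    MemLp (fun x : E => Complex.exp (-b * ‖x‖ ^ 2)) 2 volume := by
  rw [memLp_two_iff_integrable_sq_norm (integrable_gaussian hb).aestronglyMeasurable]
  have h := (integrable_gaussian (E := E) (b := 2 * b) (by simpa using hb)).norm
  refine h.congr (Filter.Eventually.of_forall fun x => ?_)
  simp only [norm_gaussian]
  rw [← Real.exp_nat_mul]
  congr 1
  simp
  ring

/-- The odd Gaussian `r e^{-br²}`. -/
def oddGaussian (b : ℂ) (r : ℝ) : ℂ := r * Complex.exp (-b * r ^ 2)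

theorem memLp_oddGaussian {b : ℂ} (hb : 0 < b.re) : MemLp (oddGaussian b) 2 volume := by
  have h := memLp_gaussian (E := ℝ) (b := ((b.re / 2 : ℝ) : ℂ)) (by simpa using hb)
  refine (h.const_mul ((1 + 2 / b.re : ℝ) : ℂ)).of_le
    (Continuous.aestronglyMeasurable (by unfold oddGaussian; fun_prop))
    (Filter.Eventually.of_forall fun r => ?_)
  rw [oddGaussian, norm_mul, norm_mul, norm_gaussian, norm_gaussian, Complex.norm_real,
    Complex.norm_real, Real.norm_of_nonneg (by positivity : 0 ≤ 1 + 2 / b.re), Complex.ofReal_re,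
    Real.norm_eq_abs, sq_abs]
  have e : Real.exp (-b.re * r ^ 2) = Real.exp (-(b.re / 2) * r ^ 2) *
      Real.exp (-(b.re / 2) * r ^ 2) := by
    rw [← Real.exp_add]
    congr 1
    ring
  rw [e, ← mul_assoc]
  refine mul_le_mul_of_nonneg_right ?_ (Real.exp_pos _).le
  have h1 : b.re / 2 * r ^ 2 + 1 ≤ Real.exp (b.re / 2 * r ^ 2) := Real.add_one_le_exp _
  have h2 : Real.exp (-(b.re / 2) * r ^ 2) = (Real.exp (b.re / 2 * r ^ 2))⁻¹ := by
    rw [← Real.exp_neg, neg_mul]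
  rw [h2, ← div_eq_mul_inv, div_le_iff₀ (Real.exp_pos _)]
  have h3 : |r| ≤ 1 + r ^ 2 := by nlinarith [sq_abs r, sq_nonneg (|r| - 1), abs_nonneg r]
  have h4 : 1 + r ^ 2 ≤ (1 + 2 / b.re) * (b.re / 2 * r ^ 2 + 1) := by
    have : (1 + 2 / b.re) * (b.re / 2 * r ^ 2 + 1) =
        1 + r ^ 2 + (b.re / 2 * r ^ 2 + 2 / b.re) := by
      field_simp
      ring
    rw [this]
    have : 0 ≤ b.re / 2 * r ^ 2 + 2 / b.re := by positivity
    linarith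
  exact h3.trans (h4.trans (mul_le_mul_of_nonneg_left h1 (by positivity)))

theorem fourier_oddGaussian {b : ℂ} (hb : 0 < b.re) :
    Lp.fourierTransformₗᵢ ℝ ℂ (memLp_oddGaussian hb).toLp =ᵐ[volume] fun ξ : ℝ =>
      -Complex.I * (Real.pi / b) ^ (3 / 2 : ℂ) * (ξ * Complex.exp (-Real.pi ^ 2 * ξ ^ 2 / b)) := by
  have hb0 : b ≠ 0 := fun h => by simp [h] at hb
  have hsq : ∀ x : ℝ, ((‖x‖ : ℝ) : ℂ) ^ 2 = (x : ℂ) ^ 2 := fun x => by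
    rw [← Complex.ofReal_pow, Real.norm_eq_abs, sq_abs, Complex.ofReal_pow]
  set φ : ℝ → ℂ := fun x => -1 / (2 * b) * Complex.exp (-b * ‖x‖ ^ 2) with hφ
  have hm : MemLp φ 2 volume := (memLp_gaussian hb).const_mul _
  have hi : Integrable φ := (integrable_gaussian hb).const_mul _
  have hd : ∀ x, HasDerivAt φ (oddGaussian b x) x := fun x => by
    have h1 : HasDerivAt (fun z : ℂ => -1 / (2 * b) * Complex.exp (-b * z ^ 2))
        (-1 / (2 * b) * (Complex.exp (-b * x ^ 2) * (-b * (2 * x)))) (x : ℂ) := by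
      have := (((hasDerivAt_id (x : ℂ)).pow 2).const_mul (-b)).cexp.const_mul (-1 / (2 * b))
      simpa using this
    have h2 := h1.comp_ofReal
    simp only [hφ, hsq, oddGaussian]
    convert h2 using 1
    field_simp
  filter_upwards [fourier_deriv_L2 hd hm (memLp_oddGaussian hb), fourier_toLp_ae_eq hm hi]
    with ξ h1 h2
  have h3 : 𝓕 φ ξ = -1 / (2 * b) * 𝓕 (fun x : ℝ => Complex.exp (-b * ‖x‖ ^ 2)) ξ := by
    rw [Real.fourier_eq', Real.fourier_eq', ← integral_const_mul]
    refine integral_congr_ae (Filter.Eventually.of_forall fun x => ?_)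
    simp only [hφ, smul_eq_mul]
    ring
  have hp : (Real.pi / b : ℂ) ≠ 0 := div_ne_zero (by exact_mod_cast Real.pi_ne_zero) hb0
  have h4 : (Real.pi / b : ℂ) ^ (3 / 2 : ℂ) = Real.pi / b * (Real.pi / b : ℂ) ^ (1 / 2 : ℂ) := by
    rw [show (3 / 2 : ℂ) = 1 + 1 / 2 by norm_num, Complex.cpow_add _ _ hp, Complex.cpow_one]
  rw [h1, h2, h3, fourier_gaussian_innerProductSpace hb, h4, hsq, Module.finrank_self, Nat.cast_one]
  field_simp

theorem fourier_radialLift_oddGaussian {b : ℂ} (hb : 0 < b.re) :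
    Lp.fourierTransformₗᵢ (EuclideanSpace ℝ (Fin 3)) ℂ
        (radialLift (memLp_oddGaussian hb).toLp) =
      Complex.I • radialLift (Lp.fourierTransformₗᵢ ℝ ℂ (memLp_oddGaussian hb).toLp) := by
  set G : EuclideanSpace ℝ (Fin 3) → ℂ := fun x => Complex.exp (-b * ‖x‖ ^ 2) with hG
  have hne : ∀ᵐ x : EuclideanSpace ℝ (Fin 3), x ≠ 0 := by
    simp [ae_iff]
  set c : ℂ := ((√(4 * Real.pi) : ℝ) : ℂ)⁻¹ with hc
  have h1 : radialLift (memLp_oddGaussian hb).toLp = c • (memLp_gaussian hb).toLp G := by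
    refine Lp.ext ?_
    filter_upwards [radialLift_coeFn (memLp_oddGaussian hb).toLp,
      radialFun_congr (memLp_oddGaussian hb).coeFn_toLp, Lp.coeFn_smul c ((memLp_gaussian hb).toLp G),
      (memLp_gaussian hb).coeFn_toLp, hne] with x a1 a2 a3 a4 a5
    have hx : ((‖x‖ : ℝ) : ℂ) ≠ 0 := by exact_mod_cast norm_ne_zero_iff.2 a5
    rw [a1, a2, a3, Pi.smul_apply, a4, radialFun, oddGaussian, hc, smul_eq_mul, Complex.ofReal_mul]
    field_simp
  rw [h1, map_smul]
  refine Lp.ext ?_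
  filter_upwards [Lp.coeFn_smul c (Lp.fourierTransformₗᵢ (EuclideanSpace ℝ (Fin 3)) ℂ
      ((memLp_gaussian hb).toLp G)), fourier_toLp_ae_eq (memLp_gaussian hb) (integrable_gaussian hb),
    Lp.coeFn_smul Complex.I (radialLift (Lp.fourierTransformₗᵢ ℝ ℂ (memLp_oddGaussian hb).toLp)),
    radialLift_coeFn (Lp.fourierTransformₗᵢ ℝ ℂ (memLp_oddGaussian hb).toLp),
    radialFun_congr (fourier_oddGaussian hb), hne] with x a1 a2 a3 a4 a5 a6
  have hx : ((‖x‖ : ℝ) : ℂ) ≠ 0 := by exact_mod_cast norm_ne_zero_iff.2 a6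
  have h4 : ((√(4 * Real.pi) : ℝ) : ℂ) ≠ 0 := by
    have : 0 < √(4 * Real.pi) := by positivity
    exact_mod_cast this.ne'
  rw [a1, a3, Pi.smul_apply, Pi.smul_apply, a2, a4, a5, radialFun,
    fourier_gaussian_innerProductSpace hb, finrank_euclideanSpace, Fintype.card_fin, hc, smul_eq_mul,
    smul_eq_mul, Complex.ofReal_mul]
  push_cast
  field_simp
  linear_combination (Real.pi / b : ℂ) ^ (3 / 2 : ℂ) * Complex.I_sq

end Radial

/-- The Fourier integral is injective on `L¹(ℝ)`. -/
theorem ae_eq_zero_of_fourier_eq_zero {G : ℝ → ℂ} (hG : Integrable G) (h : ∀ t, 𝓕 G t = 0) :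
    ∀ᵐ x, G x = 0 := by
  refine ae_eq_zero_of_integral_contDiff_smul_eq_zero hG.locallyIntegrable fun g hg hc => ?_
  have hg₁ : HasCompactSupport (Complex.ofRealCLM ∘ g) := hc.comp_left rfl
  have hg₂ : ContDiff ℝ (⊤ : ℕ∞) (Complex.ofRealCLM ∘ g) := by fun_prop
  set θ := hg₁.toSchwartzMap hg₂ with hθ
  have h1 := integral_fourier_mul_L1 (𝓕⁻ θ).integrable hG
  rw [← SchwartzMap.fourier_coe, FourierTransform.fourier_fourierInv_eq] at h1
  simp only [h, mul_zero, integral_zero] at h1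
  simpa [hθ] using h1

theorem integral_eq_integral_Ioi_add_comp_neg {F : ℝ → ℂ} (hF : Integrable F) :
    ∫ x, F x = ∫ x in Set.Ioi 0, (F x + F (-x)) := by
  rw [integral_add hF.integrableOn hF.comp_neg.integrableOn, integral_comp_neg_Ioi, neg_zero,
    add_comm, intervalIntegral.integral_Iic_add_Ioi hF.integrableOn hF.integrableOn]

/-- The change of variables `y = r²` on the half line. -/
theorem integral_Ioi_comp_sq {F : Type*} [NormedAddCommGroup F] [NormedSpace ℝ F] (k : ℝ → F) :
    ∫ r in Set.Ioi (0 : ℝ), (2 * r) • k (r ^ 2) = ∫ y in Set.Ioi 0, k y := by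
  rw [← integral_comp_rpow_Ioi_of_pos (g := k) zero_lt_two]
  refine setIntegral_congr_fun measurableSet_Ioi fun r _ => ?_
  norm_num

theorem integrableOn_Ioi_comp_sq_iff {F : Type*} [NormedAddCommGroup F] [NormedSpace ℝ F]
    (k : ℝ → F) : IntegrableOn (fun r : ℝ => (2 * r) • k (r ^ 2)) (Set.Ioi 0) ↔
      IntegrableOn k (Set.Ioi 0) := by
  rw [← integrableOn_Ioi_comp_rpow_iff k two_ne_zero]
  refine integrableOn_congr_fun (fun r _ => ?_) measurableSet_Ioi
  norm_num

/-- A function on the half line with vanishing Gaussian moments is zero. -/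
theorem ae_eq_zero_of_integral_gaussian_eq_zero {η : ℝ → ℂ}
    (hη : IntegrableOn (fun r : ℝ => (r * Complex.exp (-r ^ 2)) * η r) (Set.Ioi 0))
    (h : ∀ t : ℝ, ∫ r in Set.Ioi (0 : ℝ),
      (r * Complex.exp (-(1 + 2 * Real.pi * t * Complex.I) * r ^ 2)) * η r = 0) :
    ∀ᵐ r, r ∈ Set.Ioi (0 : ℝ) → η r = 0 := by
  set k : ℝ → ℂ := fun y => (1 / 2) * Complex.exp (-y) * η (√y) with hk
  have hkr : Set.EqOn (fun r : ℝ => (2 * r) • k (r ^ 2))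
      (fun r : ℝ => (r * Complex.exp (-r ^ 2)) * η r) (Set.Ioi 0) := fun r hr => by
    simp only [hk, Real.sqrt_sq (le_of_lt (Set.mem_Ioi.1 hr)), Complex.real_smul]
    push_cast
    ring
  have hki : IntegrableOn k (Set.Ioi 0) := by
    rw [← integrableOn_Ioi_comp_sq_iff, integrableOn_congr_fun hkr measurableSet_Ioi]
    exact hη
  have h0 : ∀ᵐ y, (Set.Ioi 0).indicator k y = 0 := by
    refine ae_eq_zero_of_fourier_eq_zero ((integrable_indicator_iff measurableSet_Ioi).2 hki)
      fun t => ?_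
    rw [Real.fourier_eq', ← h t]
    have e1 : (fun y : ℝ => Complex.exp ((-2 * Real.pi * inner ℝ y t : ℝ) * Complex.I) •
        (Set.Ioi 0).indicator k y) = (Set.Ioi 0).indicator
          (fun y : ℝ => Complex.exp (-(2 * Real.pi * t * y) * Complex.I) * k y) := by
      ext y
      by_cases hy : y ∈ Set.Ioi (0 : ℝ)
      · rw [Set.indicator_of_mem hy, Set.indicator_of_mem hy, smul_eq_mul]
        congr 2
        simp
        ring
      · rw [Set.indicator_of_notMem hy, Set.indicator_of_notMem hy, smul_zero]
    rw [e1, integral_indicator measurableSet_Ioi, ← integral_Ioi_comp_sq]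
    refine setIntegral_congr_fun measurableSet_Ioi fun r hr => ?_
    have e2 : Complex.exp (-(1 + 2 * Real.pi * t * Complex.I) * r ^ 2) =
        Complex.exp (-(2 * Real.pi * t * r ^ 2) * Complex.I) * Complex.exp (-r ^ 2) := by
      rw [← Complex.exp_add]
      congr 1
      ring
    have e3 := hkr hr
    simp only [Complex.real_smul] at e3 ⊢
    rw [mul_left_comm, e3, e2]
    push_cast
    ring
  have h1 : ∫ y in Set.Ioi 0, ‖k y‖ = 0 := by
    rw [integral_eq_zero_iff_of_nonneg (fun _ => norm_nonneg _) hki.norm]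
    refine (ae_restrict_iff' measurableSet_Ioi).2 ?_
    filter_upwards [h0] with y hy hy0
    rw [Set.indicator_of_mem hy0] at hy
    simp [hy]
  rw [← integral_Ioi_comp_sq, setIntegral_eq_zero_iff_of_nonneg_ae] at h1
  · have h2 := (ae_restrict_iff' measurableSet_Ioi).1 h1
    filter_upwards [h2] with r h3 hr
    have hr0 : (0 : ℝ) < r := hr
    have h4 := h3 hr
    simp only [hk, Real.sqrt_sq hr0.le, Pi.zero_apply, smul_eq_mul] at h4
    have h5 := (mul_eq_zero.1 h4).resolve_left (by positivity)
    rw [norm_eq_zero] at h5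
    exact (mul_eq_zero.1 h5).resolve_left (mul_ne_zero (by norm_num) (Complex.exp_ne_zero _))
  · exact (ae_restrict_iff' measurableSet_Ioi).2 (Filter.Eventually.of_forall fun r hr => by
      have hr0 : (0 : ℝ) < r := hr
      simp only [Pi.zero_apply, smul_eq_mul]
      positivity)
  · exact (integrableOn_Ioi_comp_sq_iff _).2 hki.norm

open ComplexConjugate in
theorem inner_oddGaussian {b : ℂ} (hb : 0 < b.re) (ψ : L2 ℝ) :
    inner ℂ ((memLp_oddGaussian hb).toLp) ψ = ∫ r in Set.Ioi (0 : ℝ),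
      (r * Complex.exp (-conj b * r ^ 2)) * (ψ r - ψ (-r)) := by
  have hi : Integrable fun r => conj (oddGaussian b r) * ψ r :=
    (memLp_oddGaussian hb).star.integrable_mul (Lp.memLp ψ)
  have h1 : inner ℂ ((memLp_oddGaussian hb).toLp) ψ = ∫ r, conj (oddGaussian b r) * ψ r := by
    rw [L2.inner_def]
    refine integral_congr_ae ?_
    filter_upwards [(memLp_oddGaussian hb).coeFn_toLp] with r hr
    rw [hr, RCLike.inner_apply']
  have h2 : ∀ r : ℝ, conj (oddGaussian b r) = r * Complex.exp (-conj b * r ^ 2) := fun r => by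
    simp [oddGaussian, ← Complex.exp_conj]
  rw [h1, integral_eq_integral_Ioi_add_comp_neg hi]
  refine setIntegral_congr_fun measurableSet_Ioi fun r _ => ?_
  simp only [h2]
  push_cast
  rw [neg_sq]
  ring

/-- A function orthogonal to all odd Gaussians is even. -/
theorem even_of_inner_oddGaussian_eq_zero {ψ : L2 ℝ}
    (h : ∀ (b : ℂ) (hb : 0 < b.re), inner ℂ ((memLp_oddGaussian hb).toLp) ψ = 0) :
    ∀ᵐ r, r ∈ Set.Ioi (0 : ℝ) → ψ r - ψ (-r) = 0 := by
  refine ae_eq_zero_of_integral_gaussian_eq_zero ?_ fun t => ?_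
  · have hm : MemLp (fun r => ψ r - ψ (-r)) 2 volume := (Lp.memLp ψ).sub (memLp_comp_neg ψ)
    have := (memLp_oddGaussian (b := 1) (by simp)).integrable_mul hm
    refine this.integrableOn.congr (Filter.Eventually.of_forall fun r => ?_)
    simp [oddGaussian]
  · have hb : 0 < (1 - 2 * Real.pi * t * Complex.I : ℂ).re := by simp
    have h1 := h _ hb
    rw [inner_oddGaussian hb] at h1
    rw [← h1]
    congr 1
    ext r
    congr 4
    simp [map_ofNat]

theorem mem_closure_span_oddGaussian {φ : L2 ℝ} (hφ : ∀ᵐ r, φ (-r) = -1 * φ r) :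
    φ ∈ (Submodule.span ℂ
      {ψ : L2 ℝ | ∃ (b : ℂ) (hb : 0 < b.re), ψ = (memLp_oddGaussian hb).toLp}).topologicalClosure := by
  rw [← Submodule.orthogonal_orthogonal_eq_closure]
  intro ψ hψ
  have h1 := even_of_inner_oddGaussian_eq_zero (ψ := ψ)
    fun b hb => hψ _ (Submodule.subset_span ⟨b, hb, rfl⟩)
  rw [L2.inner_def, integral_eq_integral_Ioi_add_comp_neg (L2.integrable_inner ψ φ)]
  refine integral_eq_zero_of_ae ((ae_restrict_iff' measurableSet_Ioi).2 ?_)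
  filter_upwards [h1, hφ] with r a1 a2 hr
  rw [a2, ← sub_eq_zero.1 (a1 hr), neg_one_mul, inner_neg_right, add_neg_cancel]
  rfl

/-- The Fourier transform of a radial function on `ℝ³` in terms of the Fourier transform of its odd
reduced profile. -/
theorem fourier_radialLift {φ : L2 ℝ} (hφ : ∀ᵐ r, φ (-r) = -1 * φ r) :
    Lp.fourierTransformₗᵢ (EuclideanSpace ℝ (Fin 3)) ℂ (radialLift φ) =
      Complex.I • radialLift (Lp.fourierTransformₗᵢ ℝ ℂ φ) := by
  set D : L2 ℝ →L[ℂ] L2 (EuclideanSpace ℝ (Fin 3)) :=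
    ((Lp.fourierTransformₗᵢ (EuclideanSpace ℝ (Fin 3)) ℂ).toContinuousLinearEquiv :
      L2 (EuclideanSpace ℝ (Fin 3)) →L[ℂ] L2 (EuclideanSpace ℝ (Fin 3))).comp radialLift -
    Complex.I • radialLift.comp ((Lp.fourierTransformₗᵢ ℝ ℂ).toContinuousLinearEquiv :
      L2 ℝ →L[ℂ] L2 ℝ) with hD
  have hle : (Submodule.span ℂ
      {ψ : L2 ℝ | ∃ (b : ℂ) (hb : 0 < b.re), ψ = (memLp_oddGaussian hb).toLp}).topologicalClosure ≤
      D.ker := by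
    refine Submodule.topologicalClosure_minimal _ (Submodule.span_le.2 ?_) D.isClosed_ker
    rintro _ ⟨b, hb, rfl⟩
    exact sub_eq_zero.2 (fourier_radialLift_oddGaussian hb)
  exact sub_eq_zero.1 (hle (mem_closure_span_oddGaussian hφ))

namespace MosesTuan

lemma kinetic_radialLift_u (m : ℝ) :
    (fun ξ : EuclideanSpace ℝ (Fin 3) =>
      ((√(‖(2 * Real.pi) • ξ‖ ^ 2 + m ^ 2) - m : ℝ) : ℂ) *
        Lp.fourierTransformₗᵢ (EuclideanSpace ℝ (Fin 3)) ℂ (radialLift (u m)) ξ) =ᵐ[volume]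
      Lp.fourierTransformₗᵢ (EuclideanSpace ℝ (Fin 3)) ℂ (radialLift (kineticU m)) := by
  rw [fourier_radialLift (u_neg m), fourier_radialLift (kineticU_neg m)]
  filter_upwards [Lp.coeFn_smul Complex.I (radialLift (Lp.fourierTransformₗᵢ ℝ ℂ (u m))),
    Lp.coeFn_smul Complex.I (radialLift (Lp.fourierTransformₗᵢ ℝ ℂ (kineticU m))),
    radialLift_coeFn (Lp.fourierTransformₗᵢ ℝ ℂ (u m)),
    radialLift_coeFn (Lp.fourierTransformₗᵢ ℝ ℂ (kineticU m)),
    radialFun_congr (fourier_kineticU m)] with ξ h1 h2 h3 h4 h5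
  rw [h1, h2, Pi.smul_apply, Pi.smul_apply, h3, h4, h5, radialFun, radialFun, norm_smul,
    Real.norm_of_nonneg Real.two_pi_pos.le, abs_of_nonneg (by positivity), smul_eq_mul, smul_eq_mul]
  ring

lemma radialLift_u_mem_domain (m : ℝ) :
    radialLift (u m) ∈ (relKinetic (EuclideanSpace ℝ (Fin 3)) m).domain :=
  (Lp.memLp _).ae_eq (kinetic_radialLift_u m).symm

lemma relKinetic_radialLift_u (m : ℝ) :
    relKinetic (EuclideanSpace ℝ (Fin 3)) m ⟨radialLift (u m), radialLift_u_mem_domain m⟩ =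
      radialLift (kineticU m) := by
  refine (Lp.fourierTransformₗᵢ (EuclideanSpace ℝ (Fin 3)) ℂ).injective (Lp.ext ?_)
  exact (fourier_momentumOp _ _).trans (kinetic_radialLift_u m)

lemma W_mul_radialLift_u {m : ℝ} (hm : 34 < m) :
    (fun x => W m x * radialLift (u m) x) =ᵐ[volume]
      ((eigval m : ℂ) • radialLift (u m) - radialLift (kineticU m) :
        L2 (EuclideanSpace ℝ (Fin 3))) := by
  filter_upwards [Lp.coeFn_sub ((eigval m : ℂ) • radialLift (u m)) (radialLift (kineticU m)),
    Lp.coeFn_smul (eigval m : ℂ) (radialLift (u m)), radialLift_coeFn (u m),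
    radialLift_coeFn (kineticU m), quasiMeasurePreserving_norm.ae (u_ne_zero hm)]
    with x h1 h2 h3 h4 h5
  rw [h1, Pi.sub_apply, h2, Pi.smul_apply, h3, h4, radialFun, radialFun, W, V, smul_eq_mul]
  change (_ - kineticU m ‖x‖ / u m ‖x‖) * _ = _
  field_simp

lemma radialLift_u_ne_zero {m : ℝ} (hm : 34 < m) : radialLift (u m) ≠ 0 := by
  intro h0
  have hne : ∀ᵐ x : EuclideanSpace ℝ (Fin 3), x ≠ 0 := by simp [ae_iff]
  have hF : ∀ᵐ x : EuclideanSpace ℝ (Fin 3), False := by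
    filter_upwards [radialLift_coeFn (u m), Lp.coeFn_zero ℂ 2
      (volume : Measure (EuclideanSpace ℝ (Fin 3))),
      quasiMeasurePreserving_norm.ae (u_ne_zero hm), hne] with x h1 h2 h3 h4
    rw [h0, h2, Pi.zero_apply, radialFun, eq_comm, div_eq_zero_iff] at h1
    refine h1.elim h3 fun h => ?_
    have : 0 < √(4 * Real.pi) * ‖x‖ := mul_pos (by positivity) (norm_pos_iff.2 h4)
    exact this.ne' (by exact_mod_cast h)
  exact hF.exists.elim fun _ h => h

end MosesTuan

end

/-- The first four conjuncts say that `f̃`, `(√(p² + m²) - m) ũ` and the quotient defining `Ṽ` are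
meaningful and that `Ṽ` is real; the last one is the eigenvalue equation in `L²(ℝ³)`. -/
theorem mainTheorem8 (m : ℝ) (hm : 34 < m) :
    MosesTuan.hL2 ∈ (MosesTuan.shiftOp m).domain ∧
    MosesTuan.u m ∈ (relKinetic ℝ m).domain ∧
    (∀ᵐ x : ℝ, MosesTuan.u m x ≠ 0) ∧
    (∀ᵐ x : ℝ, (MosesTuan.V m x).im = 0) ∧
    ∃ hv : MemLp (MosesTuan.v m) 2 volume,
      hv.toLp ≠ 0 ∧
      ∃ hD : hv.toLp ∈ (MosesTuan.Hr m).domain,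
        MosesTuan.Hr m ⟨hv.toLp, hD⟩ = ((MosesTuan.eigval m : ℝ) : ℂ) • hv.toLp := by
  have hv : MemLp (MosesTuan.v m) 2 volume := memLp_radialFun (Lp.memLp (MosesTuan.u m))
  have hvu : hv.toLp = radialLift (MosesTuan.u m) := rfl
  have hW : radialLift (MosesTuan.u m) ∈ (mulOp (MosesTuan.W m)).domain :=
    (Lp.memLp _).ae_eq (MosesTuan.W_mul_radialLift_u hm).symm
  refine ⟨MosesTuan.hL2_mem_domain m, MosesTuan.u_mem_domain m, MosesTuan.u_ne_zero hm,
    MosesTuan.V_im m, hv, ?_⟩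
  rw [hvu]
  refine ⟨MosesTuan.radialLift_u_ne_zero hm,
    ⟨MosesTuan.radialLift_u_mem_domain m, hW⟩, ?_⟩
  have h2 : mulOp (MosesTuan.W m) ⟨radialLift (MosesTuan.u m), hW⟩ =
      (MosesTuan.eigval m : ℂ) • radialLift (MosesTuan.u m) -
        radialLift (MosesTuan.kineticU m) :=
    Lp.ext ((mulOp_coeFn _ _).trans (MosesTuan.W_mul_radialLift_u hm))
  change relKinetic (EuclideanSpace ℝ (Fin 3)) m
      ⟨radialLift (MosesTuan.u m), MosesTuan.radialLift_u_mem_domain m⟩ +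
    mulOp (MosesTuan.W m) ⟨radialLift (MosesTuan.u m), hW⟩ = _
  rw [MosesTuan.relKinetic_radialLift_u, h2, add_sub_cancel]
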